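/- Let $M$ be a Riemann surface; "smooth" means $C^\infty$ in the real sense. A \emph{Weierstrass representation} of $M$ is a nowhere vanishing triple $\omega=(\omega_1,\omega_2,\omega_3)$ of smooth $(1,0)$-forms on $M$ with $\omega_1^2+\omega_2^2+\omega_3^2=0$. It satisfies the \emph{integrability condition} if $d(\operatorname{Re}\omega)=0$, and the \emph{period condition} if $\operatorname{Re}\int_\gamma\omega=0$ for every piecewise smooth loop $\gamma$ in $M$. A smooth map $\varphi\colon M\to\mathbb R^3$ \emph{induces} $\omega$ if $\omega=2\partial\varphi$, i.e. $\omega(w)=d\varphi(w)-i\,d\varphi(Iw)$, where $I$ is the complex structure of $TM$. A \emph{spinor representation} $(S,u,v)$ of $M$ consists of a smooth complex line bundle $S\to M$, a smooth fibrewise surjective bundle map $S\to TM$, $s\mapsto s^2$, which is complex-quadratic on each fibre, and two smooth sections $u,v$ of the complex dual of $S$ without common zeros. For sections $\xi,\xi'$ of the dual of $S$ let $\xi\xi'$ be the $(1,0)$-form with $(\xi\xi')(s^2)=\xi(s)\xi'(s)$. Then $(S,u,v)$ determines the Weierstrass representation $$\omega(S,u,v)=\bigl(u^2-v^2,\; i(u^2+v^2),\;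 2uv\bigr),$$ and every Weierstrass representation of $M$ arises in this way. The group $$G=\Bigl\{T=\begin{pmatrix} a&-\bar b\\ b&\bar a\end{pmatrix} : a,b\in\mathbb C \text{ not both } 0\Bigr\}\subset \mathrm{GL}(2,\mathbb C),$$ which is isomorphic to $\mathbb H^\times$, and to $\mathbb R^+\times \mathrm{SU}(2)$ by $(r,U)\mapsto rU$, acts on spinor representations by $T\cdot(S,u,v)=(S,\,au-\bar b v,\,bu+\bar a v)$. For $T\in G$ put $$\widehat T=\begin{pmatrix}\operatorname{Re}(a^2-b^2)&\operatorname{Im}(a^2-b^2)&-2\operatorname{Re}(\bar a b)\\ -\operatorname{Im}(a^2+b^2)&\operatorname{Re}(a^2+b^2)&-2\operatorname{Im}(\bar a b)\\ 2\operatorname{Re}(ab)&2\operatorname{Im}(ab)&|a|^2-|b|^2\end{pmatrix}.$$ Then: 1. For every $T\in G$ and every spinor representation $R$ of $M$: if $\omega(R)$ satisfies the integrability condition, so does $\omega(T\cdot R)$; and if $\omega(R)$ satisfies the period condition, so does $\omega(T\cdot R)$. 2. $\omega(T\cdot R)=\widehat T\,\omega(R)$; moreover $\widehat{TT'}=\widehat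 T\,\widehat{T'}$, and $\widehat T$ is $|a|^2+|b|^2>0$ times an element of $\mathrm{SO}(3)$. In particular $\omega(T\cdot R)$ depends only on $T$ and $\omega(R)$, so $G$ acts on Weierstrass representations. 3. Every conformal immersion $\varphi\colon M\to\mathbb R^3$ induces $\omega(R)$ for some spinor representation $R$. For every such $R$, every $T\in G$ and every $x\in\mathbb R^3$, the map $\widehat T\circ\varphi+x$ is a conformal immersion inducing $\omega(T\cdot R)$; and if $M$ is connected, every conformal immersion inducing $\omega(T\cdot R)$ is of this form. Thus the induced action on conformal immersions modulo translations is $\varphi\mapsto\widehat T\circ\varphi$ with $\widehat T\in\mathbb R^+\times \mathrm{SO}(3)$. -/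

import Mathlib

open scoped Manifold ContDiff Bundle Quaternion

noncomputable section

/-! ### The smooth surface underlying a Riemann surface -/

/-- A complex one-dimensional manifold is in particular a smooth real surface, with the same
charts. -/
instance riemannSurface_isManifold_real {M : Type*} [TopologicalSpace M] [ChartedSpace ℂ M]
    [IsManifold 𝓘(ℂ, ℂ) ω M] : IsManifold 𝓘(ℝ, ℂ) ω M := by
  refine isManifold_of_contDiffOn _ _ _ fun e e' he he' => ?_
  have h := (contDiffGroupoid ω 𝓘(ℂ, ℂ)).compatible he he'
  rw [contDiffGroupoid, mem_groupoid_of_pregroupoid] at h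
  exact h.1.restrict_scalars ℝ

/-- A topological complex vector bundle is a topological real vector bundle, with the same
trivializations. -/
instance vectorBundle_real_of_complex {B : Type*} [TopologicalSpace B] {E : B → Type*}
    [∀ p, AddCommGroup (E p)] [∀ p, Module ℂ (E p)] [∀ p, TopologicalSpace (E p)]
    [TopologicalSpace (Bundle.TotalSpace ℂ E)] [FiberBundle ℂ E] [VectorBundle ℂ ℂ E] :
    VectorBundle ℝ ℂ E :=
  have hlin : ∀ (e : Bundle.Trivialization ℂ (Bundle.TotalSpace.proj : Bundle.TotalSpace ℂ E → B))
      [MemTrivializationAtlas e], e.IsLinear ℝ := fun e _ =>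
    { linear := fun b hb =>
        { map_add := (Bundle.Trivialization.linear ℂ e hb).map_add
          map_smul := fun c x => by
            have := (Bundle.Trivialization.linear ℂ e hb).map_smul (c : ℂ) x
            simpa using this } }
  { trivialization_linear' := fun e _ => hlin e
    continuousOn_coordChange' := fun e e' _ _ => by
      have h := continuousOn_coordChange ℂ e e'
      have h' := (ContinuousLinearMap.restrictScalarsL ℂ ℂ ℂ ℝ ℝ).continuous.comp_continuousOn h
      have := hlin e
      have := hlin e'
      refine h'.congr fun b hb => ?_
      ext1
      simp [Bundle.Trivialization.coordChangeL_apply, hb] }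

/-! ### Complex one-forms on a Riemann surface

Throughout, `TangentSpace 𝓘(ℂ, ℂ) p` is the tangent space `T_pM` as a complex line, and
`TangentBundle 𝓘(ℝ, ℂ) M` is the tangent bundle as a smooth real manifold; their fibres are the
same. Smooth always means `C^∞` in the real sense. -/

section Forms

variable (M : Type*) [TopologicalSpace M] [ChartedSpace ℂ M] [IsManifold 𝓘(ℂ, ℂ) ω M]

/-- A (not necessarily continuous) triple of `(1,0)`-forms: a map `TM → ℂ³` which is complex-linear
on each fibre. -/
abbrev TripleForm : Type _ := ∀ p : M, TangentSpace 𝓘(ℂ, ℂ) p →L[ℂ] (Fin 3 → ℂ)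

variable {M}

/-- A Weierstrass representation: a smooth map `TM → ℂ³` mapping each fibre complex-linearly onto
a line in the cone `Q` of isotropic vectors, that is, a nowhere vanishing triple of smooth
`(1,0)`-forms with `ω₁² + ω₂² + ω₃² = 0`. -/
structure TripleForm.IsWeierstrass (η : TripleForm M) : Prop where
  smooth : ContMDiff 𝓘(ℝ, ℂ).tangent 𝓘(ℝ, Fin 3 → ℂ) ∞
    (fun w : TangentBundle 𝓘(ℝ, ℂ) M => η w.1 w.2)
  ne_zero : ∀ p, η p ≠ 0
  isotropic : ∀ p w, ∑ j, η p w j ^ 2 = 0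

/-- The real part of a triple of complex-valued 1-forms, in a holomorphic chart `e`, as an
`ℝ³`-valued 1-form on an open subset of `ℂ` (the pull-back by `e.symm`). -/
def TripleForm.reInChart (η : TripleForm M) (e : OpenPartialHomeomorph M ℂ) (z : ℂ) :
    ℂ →L[ℝ] (Fin 3 → ℝ) :=
  let ηz : ℂ →L[ℂ] (Fin 3 → ℂ) := (η (e.symm z)).comp (mfderiv 𝓘(ℂ, ℂ) 𝓘(ℂ, ℂ) e.symm z)
  ContinuousLinearMap.pi fun j =>
    Complex.reCLM.comp ((ContinuousLinearMap.proj j).comp (ηz.restrictScalars ℝ))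

/-- The integrability condition `d (Re ω) = 0`, expressed in the charts of `M`. -/
def TripleForm.Integrability (η : TripleForm M) : Prop :=
  ∀ e ∈ atlas ℂ M, ∀ z ∈ e.target,
    extDeriv (fun z => ContinuousAlternatingMap.ofSubsingleton ℝ ℂ (Fin 3 → ℝ) (0 : Fin 1)
      (η.reInChart e z)) z = 0

/-- `γ` restricted to `[0, 1]` is a piecewise smooth loop. -/
def IsPiecewiseSmoothLoop (γ : ℝ → M) : Prop :=
  γ 0 = γ 1 ∧ ∃ (n : ℕ) (t : ℕ → ℝ), Monotone t ∧ t 0 = 0 ∧ t n = 1 ∧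
    ∀ i < n, ContMDiffOn 𝓘(ℝ, ℝ) 𝓘(ℝ, ℂ) ∞ γ (Set.Icc (t i) (t (i + 1)))

/-- The velocity `γ'(t) ∈ T_{γ(t)} M`. -/
def velocity (γ : ℝ → M) (t : ℝ) : TangentSpace 𝓘(ℂ, ℂ) (γ t) :=
  (mfderiv 𝓘(ℝ, ℝ) 𝓘(ℝ, ℂ) γ t : ℝ →L[ℝ] ℂ) 1

/-- The integral of `η` along `γ` restricted to `[0, 1]`. -/
def TripleForm.pathIntegral (η : TripleForm M) (γ : ℝ → M) : Fin 3 → ℂ :=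
  ∫ t in (0 : ℝ)..1, η (γ t) (velocity γ t)

/-- The period condition: all periods (integrals along piecewise smooth loops) are purely
imaginary. -/
def TripleForm.PeriodCondition (η : TripleForm M) : Prop :=
  ∀ γ : ℝ → M, IsPiecewiseSmoothLoop γ → ∀ j, (η.pathIntegral γ j).re = 0

/-- The differential `dφ_p : T_pM → ℝ³`, where `T_pM` is identified with `ℂ` by the preferred
holomorphic chart at `p` (this is how tangent spaces are represented). -/
def differential (φ : M → EuclideanSpace ℝ (Fin 3)) (p : M) :
    ℂ →L[ℝ] EuclideanSpace ℝ (Fin 3) :=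
  mfderiv 𝓘(ℝ, ℂ) 𝓘(ℝ, EuclideanSpace ℝ (Fin 3)) φ p

/-- Conformal immersions `M → ℝ³`. The metric of `ℂ` on `T_pM` lies in the conformal class given
by the complex structure; `IsConformalMap` means a nonzero multiple of a linear isometry. -/
structure IsConformalImmersion (φ : M → EuclideanSpace ℝ (Fin 3)) : Prop where
  smooth : ContMDiff 𝓘(ℝ, ℂ) 𝓘(ℝ, EuclideanSpace ℝ (Fin 3)) ∞ φ
  conformal : ∀ p, IsConformalMap (differential φ p)

/-- `η = 2∂φ`, that is, `η(w) = dφ(w) - i dφ(Iw)`, where `I` is the complex structure of `TM`. -/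
def TripleForm.IsInducedBy (η : TripleForm M) (φ : M → EuclideanSpace ℝ (Fin 3)) : Prop :=
  ∀ p w j, η p w j =
    (differential φ p w j : ℂ) - Complex.I * (differential φ p (Complex.I • w) j : ℂ)

end Forms

/-! ### Square roots of the tangent bundle and spinor representations -/

section Spinors

variable (M : Type*) [TopologicalSpace M] [ChartedSpace ℂ M] [IsManifold 𝓘(ℂ, ℂ) ω M]

/-- A square root of `TM`: a smooth complex line bundle `S → M` together with a
smooth surjective bundle map `S → TM` which is complex-quadratic on each fibre. -/
structure TangentSquareRoot where
  fiber : M → Type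
  [addCommGroup : ∀ p, AddCommGroup (fiber p)]
  [module : ∀ p, Module ℂ (fiber p)]
  [topFiber : ∀ p, TopologicalSpace (fiber p)]
  [topTotal : TopologicalSpace (Bundle.TotalSpace ℂ fiber)]
  [fiberBundle : FiberBundle ℂ fiber]
  [vectorBundle : VectorBundle ℂ ℂ fiber]
  [smoothBundle : ContMDiffVectorBundle ∞ ℂ fiber 𝓘(ℝ, ℂ)]
  sq : ∀ p, QuadraticMap ℂ (fiber p) (TangentSpace 𝓘(ℂ, ℂ) p)
  sq_surjective : ∀ p, Function.Surjective (sq p)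
  sq_smooth : ContMDiff (𝓘(ℝ, ℂ).prod 𝓘(ℝ, ℂ)) 𝓘(ℝ, ℂ).tangent ∞
    (fun s : Bundle.TotalSpace ℂ fiber => (⟨s.1, sq s.1 s.2⟩ : TangentBundle 𝓘(ℝ, ℂ) M))

attribute [instance] TangentSquareRoot.addCommGroup TangentSquareRoot.module
  TangentSquareRoot.topFiber TangentSquareRoot.topTotal TangentSquareRoot.fiberBundle
  TangentSquareRoot.vectorBundle TangentSquareRoot.smoothBundle

/-- A spinor representation of `M`: a square root `S` of `TM` and two smooth sections
`u, v` of the complex dual of `S` (smooth functions on the total space of `S`, complex-linear on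
each fibre) that do not vanish simultaneously. -/
structure SpinorRep extends TangentSquareRoot M where
  u : ∀ p, fiber p →ₗ[ℂ] ℂ
  v : ∀ p, fiber p →ₗ[ℂ] ℂ
  u_smooth : ContMDiff (𝓘(ℝ, ℂ).prod 𝓘(ℝ, ℂ)) 𝓘(ℝ, ℂ) ∞
    (fun s : Bundle.TotalSpace ℂ fiber => u s.1 s.2)
  v_smooth : ContMDiff (𝓘(ℝ, ℂ).prod 𝓘(ℝ, ℂ)) 𝓘(ℝ, ℂ) ∞
    (fun s : Bundle.TotalSpace ℂ fiber => v s.1 s.2)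
  ne_zero : ∀ p, ¬ (u p = 0 ∧ v p = 0)

variable {M}

/-- `√w`, one of the preimages of `w ∈ T_pM` in `S_p`. -/
def TangentSquareRoot.sqrt (S : TangentSquareRoot M) {p : M} (w : TangentSpace 𝓘(ℂ, ℂ) p) :
    S.fiber p :=
  (S.sq_surjective p w).choose

theorem TangentSquareRoot.sq_sqrt (S : TangentSquareRoot M) {p : M}
    (w : TangentSpace 𝓘(ℂ, ℂ) p) : S.sq p (S.sqrt w) = w :=
  (S.sq_surjective p w).choose_spec

/-- Each fibre is a complex line spanned by a vector with nonzero square. -/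
theorem TangentSquareRoot.exists_generator (S : TangentSquareRoot M) (p : M) :
    ∃ s₀ : S.fiber p, S.sq p s₀ ≠ 0 ∧ ∀ s : S.fiber p, ∃ c : ℂ, s = c • s₀ := by
  let e := (trivializationAt ℂ S.fiber p).linearEquivAt ℂ p
    (FiberBundle.mem_baseSet_trivializationAt' p)
  have hgen : ∀ s : S.fiber p, ∃ c : ℂ, s = c • e.symm 1 := fun s =>
    ⟨e s, by rw [← map_smul, smul_eq_mul, mul_one, LinearEquiv.symm_apply_apply]⟩
  refine ⟨e.symm 1, fun h0 => ?_, hgen⟩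
  obtain ⟨s, hs⟩ := S.sq_surjective p (show TangentSpace 𝓘(ℂ, ℂ) p from (1 : ℂ))
  obtain ⟨c, rfl⟩ := hgen s
  rw [QuadraticMap.map_smul, h0, smul_zero] at hs
  exact zero_ne_one (α := ℂ) hs

/-- The product `ξξ'` of two functionals on `S_p`, as a functional on `T_pM`:
`ξξ'(w) = ξ(√w) ξ'(√w)`. -/
def TangentSquareRoot.mulForm (S : TangentSquareRoot M) {p : M} (ξ ξ' : S.fiber p →ₗ[ℂ] ℂ) :
    TangentSpace 𝓘(ℂ, ℂ) p →ₗ[ℂ] ℂ where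
  toFun w := ξ (S.sqrt w) * ξ' (S.sqrt w)
  map_add' w w' := by
    obtain ⟨s₀, hs₀, hgen⟩ := S.exists_generator p
    obtain ⟨a, ha⟩ := hgen (S.sqrt w)
    obtain ⟨b, hb⟩ := hgen (S.sqrt w')
    obtain ⟨c, hc⟩ := hgen (S.sqrt (w + w'))
    have h : c * c = a * a + b * b := by
      have h := S.sq_sqrt (w + w')
      nth_rewrite 2 [← S.sq_sqrt w, ← S.sq_sqrt w'] at h
      rw [ha, hb, hc, QuadraticMap.map_smul, QuadraticMap.map_smul, QuadraticMap.map_smul,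
        ← add_smul] at h
      exact mul_right_cancel₀ (b := (show ℂ from S.sq p s₀)) hs₀ h
    rw [ha, hb, hc]
    simp only [map_smul, smul_eq_mul]
    linear_combination (ξ s₀ * ξ' s₀) * h
  map_smul' k w := by
    obtain ⟨s₀, hs₀, hgen⟩ := S.exists_generator p
    obtain ⟨a, ha⟩ := hgen (S.sqrt w)
    obtain ⟨c, hc⟩ := hgen (S.sqrt (k • w))
    have h : c * c = k * (a * a) := by
      have h := S.sq_sqrt (k • w)
      nth_rewrite 2 [← S.sq_sqrt w] at h
      rw [ha, hc, QuadraticMap.map_smul, QuadraticMap.map_smul, smul_smul] at h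
      exact mul_right_cancel₀ (b := (show ℂ from S.sq p s₀)) hs₀ h
    rw [ha, hc]
    simp only [map_smul, smul_eq_mul, RingHom.id_apply]
    linear_combination (ξ s₀ * ξ' s₀) * h

/-- The Weierstrass representation `(u² - v², i(u² + v²), 2uv)` corresponding to a spinor
representation `(S, u, v)`. -/
def SpinorRep.form (R : SpinorRep M) : TripleForm M := fun p =>
  let uu := R.mulForm (R.u p) (R.u p)
  let vv := R.mulForm (R.v p) (R.v p)
  let uv := R.mulForm (R.u p) (R.v p)
  { toLinearMap := LinearMap.pi ![uu - vv, Complex.I • (uu + vv), (2 : ℂ) • uv]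
    cont := by
      have : T2Space (TangentSpace 𝓘(ℂ, ℂ) p) := inferInstanceAs (T2Space ℂ)
      have : FiniteDimensional ℂ (TangentSpace 𝓘(ℂ, ℂ) p) :=
        inferInstanceAs (FiniteDimensional ℂ ℂ)
      exact LinearMap.continuous_of_finiteDimensional _ }

/-- The spinor representation `(S, au + bv, cu + dv)`, for `g = (a, b; c, d)`. -/
def SpinorRep.act (g : GL (Fin 2) ℂ) (R : SpinorRep M) : SpinorRep M :=
  { R with
    u := fun p => g 0 0 • R.u p + g 0 1 • R.v p
    v := fun p => g 1 0 • R.u p + g 1 1 • R.v p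
    u_smooth := ((contDiff_const_smul (g 0 0)).contMDiff.comp R.u_smooth).add
      ((contDiff_const_smul (g 0 1)).contMDiff.comp R.v_smooth)
    v_smooth := ((contDiff_const_smul (g 1 0)).contMDiff.comp R.u_smooth).add
      ((contDiff_const_smul (g 1 1)).contMDiff.comp R.v_smooth)
    ne_zero := fun p ⟨h0, h1⟩ => by
      have hdet : g 0 0 * g 1 1 - g 0 1 * g 1 0 ≠ 0 := by
        have := g.isUnit.map Matrix.detMonoidHom
        simpa [Matrix.det_fin_two] using this.ne_zero
      have h0' := fun s => LinearMap.congr_fun h0 s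
      have h1' := fun s => LinearMap.congr_fun h1 s
      simp only [LinearMap.add_apply, LinearMap.smul_apply, smul_eq_mul,
        LinearMap.zero_apply] at h0' h1'
      refine R.ne_zero p ⟨LinearMap.ext fun s => ?_, LinearMap.ext fun s => ?_⟩
      · refine (mul_eq_zero_iff_left hdet).1 ?_
        linear_combination g 1 1 * h0' s - g 0 1 * h1' s
      · refine (mul_eq_zero_iff_left hdet).1 ?_
        linear_combination g 0 0 * h1' s - g 1 0 * h0' s }

/-- The action of `GL(2, ℂ)` on spinor representations. -/
instance SpinorRep.mulAction : MulAction (GL (Fin 2) ℂ) (SpinorRep M) where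
  smul := SpinorRep.act
  one_smul R := by
    change SpinorRep.act 1 R = R
    obtain ⟨S, u, v, hu, hv, h⟩ := R
    simp [SpinorRep.act]
  mul_smul g h R := by
    change SpinorRep.act (g * h) R = SpinorRep.act g (SpinorRep.act h R)
    obtain ⟨S, u, v, hu, hv, h'⟩ := R
    have key : ∀ (i : Fin 2) p (s : S.fiber p), (g * h) i 0 * u p s + (g * h) i 1 * v p s =
        g i 0 * (h 0 0 * u p s + h 0 1 * v p s) + g i 1 * (h 1 0 * u p s + h 1 1 * v p s) := by
      intro i p s
      simp only [Units.val_mul, Matrix.mul_apply, Fin.sum_univ_two]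
      ring
    unfold SpinorRep.act
    congr 1
    · exact funext fun p => LinearMap.ext (key 0 p)
    · exact funext fun p => LinearMap.ext (key 1 p)

end Spinors

/-! ### The group of nonzero quaternions -/

/-- The subgroup `{(a, -b̄; b, ā)} ≅ ℍ^× ≅ ℝ⁺ × SU(2)` of `GL(2, ℂ)`. -/
def quaternionGroup : Subgroup (GL (Fin 2) ℂ) where
  carrier := {g | ∃ a b : ℂ, (g : Matrix (Fin 2) (Fin 2) ℂ) = !![a, -star b; b, star a]}
  one_mem' := ⟨1, 0, by ext i j; fin_cases i <;> fin_cases j <;> simp⟩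
  mul_mem' := by
    rintro g h ⟨a, b, hg⟩ ⟨c, d, hh⟩
    refine ⟨a * c - star b * d, b * c + star a * d, ?_⟩
    rw [Units.val_mul, hg, hh, Matrix.mul_fin_two]
    ext i j
    fin_cases i <;> fin_cases j <;> simp <;> ring
  inv_mem' := by
    rintro g ⟨a, b, hg⟩
    refine ⟨star a / (a * star a + b * star b), -b / (a * star a + b * star b), ?_⟩
    rw [Matrix.coe_units_inv, hg, Matrix.inv_def, Matrix.adjugate_fin_two_of,
      Matrix.det_fin_two_of, Ring.inverse_eq_inv']
    ext i j
    fin_cases i <;> fin_cases j <;> simp <;> ring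

/-- The real `3 × 3` matrix `T̂` corresponding to `T = (a, -b̄; b, ā)`. -/
def hatMatrix (g : GL (Fin 2) ℂ) : Matrix (Fin 3) (Fin 3) ℝ :=
  let a : ℂ := g 0 0
  let b : ℂ := g 1 0
  !![(a ^ 2 - b ^ 2).re, (a ^ 2 - b ^ 2).im, -2 * (star a * b).re;
     -(a ^ 2 + b ^ 2).im, (a ^ 2 + b ^ 2).re, -2 * (star a * b).im;
     2 * (a * b).re, 2 * (a * b).im, ‖a‖ ^ 2 - ‖b‖ ^ 2]

end

noncomputable section

/-! ### The group of nonzero quaternions and its representation on `ℝ³` -/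

section Group

/-! The map `(x, y) ↦ (x² - y², i(x² + y²), 2xy)` parametrizes the cone `Q` of isotropic vectors in
`ℂ³` by `ℂ²`, two-to-one away from the origin. A linear change of `(x, y)` therefore induces a
linear change of `ℂ³`. For matrices whose second column is `(-b̄, ā)` the induced matrix is real,
namely `T̂` (`SpinorRep.form_act`, a polynomial identity in `a, ā, b, b̄`). It is a similarity
because `T̂ᵀT̂` and `det T̂` are powers of `|a|² + |b|²` (`hatMatrix_transpose_mul`,
`hatMatrix_det`).

A real invertible matrix commutes with `Re`, with `d` and with integration, so integrability and the
period condition are inherited (the two `real_linear` lemmas). It also commutes with `φ ↦ 2∂φ`, so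
composing `φ` with `T̂` transforms the induced form in the same way as `T` does
(`form_act_isInducedBy`).

For existence of spinors, a Weierstrass representation gives a map `M → ℙ(Q) ≅ ℙ¹`. The pull-back of
the tautological bundle is the required square root of `TM`, and the two homogeneous coordinates are
`u` and `v` (`form_spinorRep`). A conformal immersion has isotropic, nowhere vanishing `2∂φ`, so
this applies to it (`isWeierstrass_twoPartial`). Finally `Re ω = dφ` determines the differential,
hence on a connected surface `φ` up to a translation (`exists_eq_add_of_differential_eq`). -/

theorem quaternionGroup_snd_col (T : quaternionGroup) :
    T.1 0 1 = -star (T.1 1 0) ∧ T.1 1 1 = star (T.1 0 0) := by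
  obtain ⟨T, a, b, h⟩ := T
  simp [h]

theorem quaternionGroup_normSq_pos (T : quaternionGroup) :
    0 < ‖T.1 0 0‖ ^ 2 + ‖T.1 1 0‖ ^ 2 := by
  have hdet : T.1 0 0 * T.1 1 1 - T.1 0 1 * T.1 1 0 ≠ 0 := by
    have := T.1.isUnit.map Matrix.detMonoidHom
    simpa [Matrix.det_fin_two] using this.ne_zero
  rw [(quaternionGroup_snd_col T).1, (quaternionGroup_snd_col T).2] at hdet
  by_contra hle
  have h0 : ‖T.1 0 0‖ ^ 2 = 0 := by nlinarith [sq_nonneg ‖T.1 0 0‖, sq_nonneg ‖T.1 1 0‖]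
  have h1 : ‖T.1 1 0‖ ^ 2 = 0 := by nlinarith [sq_nonneg ‖T.1 0 0‖, sq_nonneg ‖T.1 1 0‖]
  refine hdet ?_
  rw [norm_eq_zero.1 (pow_eq_zero_iff two_ne_zero |>.1 h0),
    norm_eq_zero.1 (pow_eq_zero_iff two_ne_zero |>.1 h1)]
  simp

/-- The element of `quaternionGroup` with first column `(a, b)`. -/
def quaternionGroup.mk' (a b : ℂ) (h : ‖a‖ ^ 2 + ‖b‖ ^ 2 ≠ 0) : quaternionGroup :=
  ⟨Matrix.GeneralLinearGroup.mkOfDetNeZero !![a, -star b; b, star a] (by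
    have : a * star a - -star b * b = ((‖a‖ ^ 2 + ‖b‖ ^ 2 : ℝ) : ℂ) := by
      have ha := Complex.mul_conj' a
      have hb := Complex.mul_conj' b
      push_cast
      rw [← ha, ← hb]
      simp only [Complex.star_def]
      ring
    rw [Matrix.det_fin_two_of, this]
    exact_mod_cast h), a, b, rfl⟩

theorem quaternionGroup.mk'_val (a b : ℂ) (h : ‖a‖ ^ 2 + ‖b‖ ^ 2 ≠ 0) :
    ((quaternionGroup.mk' a b h : GL (Fin 2) ℂ) : Matrix (Fin 2) (Fin 2) ℂ) =
      !![a, -star b; b, star a] := rfl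

theorem quaternionGroup.ext_col {T T' : quaternionGroup} (h0 : T.1 0 0 = T'.1 0 0)
    (h1 : T.1 1 0 = T'.1 1 0) : T = T' := by
  obtain ⟨e1, e2⟩ := quaternionGroup_snd_col T
  obtain ⟨e3, e4⟩ := quaternionGroup_snd_col T'
  refine Subtype.ext (Units.ext ?_)
  ext i j
  fin_cases i <;> fin_cases j
  · exact h0
  · change T.1 0 1 = T'.1 0 1
    rw [e1, e3, h1]
  · exact h1
  · change T.1 1 1 = T'.1 1 1
    rw [e2, e4, h0]

theorem quaternionGroup_mul_col (T T' : quaternionGroup) :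
    (T * T').1 0 0 = T.1 0 0 * T'.1 0 0 - star (T.1 1 0) * T'.1 1 0 ∧
    (T * T').1 1 0 = T.1 1 0 * T'.1 0 0 + star (T.1 0 0) * T'.1 1 0 := by
  obtain ⟨e1, e2⟩ := quaternionGroup_snd_col T
  constructor
  · change ((T.1 * T'.1 : GL (Fin 2) ℂ) : Matrix (Fin 2) (Fin 2) ℂ) 0 0 = _
    rw [Units.val_mul, Matrix.mul_apply, Fin.sum_univ_two, e1]
    ring
  · change ((T.1 * T'.1 : GL (Fin 2) ℂ) : Matrix (Fin 2) (Fin 2) ℂ) 1 0 = _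
    rw [Units.val_mul, Matrix.mul_apply, Fin.sum_univ_two, e2]

theorem hatMatrix_mul (T T' : quaternionGroup) :
    hatMatrix (T * T' : quaternionGroup) = hatMatrix T * hatMatrix T' := by
  obtain ⟨h0, h1⟩ := quaternionGroup_mul_col T T'
  unfold hatMatrix
  simp only [h0, h1, Complex.sq_norm, Complex.normSq_apply]
  ext i j
  fin_cases i <;> fin_cases j <;>
    simp [Matrix.mul_apply, Fin.sum_univ_three, pow_two] <;>
    ring

/-- `T̂ᵀ T̂ = (|a|² + |b|²)²`. -/
theorem hatMatrix_transpose_mul (T : GL (Fin 2) ℂ) :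
    (hatMatrix T).transpose * hatMatrix T =
      ((‖T 0 0‖ ^ 2 + ‖T 1 0‖ ^ 2) ^ 2) • (1 : Matrix (Fin 3) (Fin 3) ℝ) := by
  unfold hatMatrix
  simp only [Complex.sq_norm, Complex.normSq_apply]
  ext i j
  fin_cases i <;> fin_cases j <;>
    simp [Matrix.mul_apply, Fin.sum_univ_three, pow_two] <;>
    ring

theorem hatMatrix_det (T : GL (Fin 2) ℂ) :
    (hatMatrix T).det = (‖T 0 0‖ ^ 2 + ‖T 1 0‖ ^ 2) ^ 3 := by
  unfold hatMatrix
  simp only [Complex.sq_norm, Complex.normSq_apply]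
  simp [Matrix.det_fin_three, pow_two]
  ring

theorem exists_hatMatrix_eq_smul (T : quaternionGroup) :
    ∃ O ∈ Matrix.specialOrthogonalGroup (Fin 3) ℝ,
      hatMatrix T = (‖T.1 0 0‖ ^ 2 + ‖T.1 1 0‖ ^ 2) • O := by
  have hpos := quaternionGroup_normSq_pos T
  set N := ‖T.1 0 0‖ ^ 2 + ‖T.1 1 0‖ ^ 2 with hN
  refine ⟨N⁻¹ • hatMatrix T, ?_, by rw [smul_smul, mul_inv_cancel₀ hpos.ne', one_smul]⟩
  rw [Matrix.mem_specialOrthogonalGroup_iff, Matrix.mem_orthogonalGroup_iff']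
  constructor
  · rw [Matrix.transpose_smul, Matrix.smul_mul, Matrix.mul_smul, hatMatrix_transpose_mul, ← hN,
      smul_smul, smul_smul]
    rw [show N⁻¹ * N⁻¹ * N ^ 2 = 1 by field_simp, one_smul]
  · rw [Matrix.det_smul, hatMatrix_det, ← hN]
    simp only [Fintype.card_fin]
    field_simp

theorem hatMatrix_isUnit_det (T : quaternionGroup) : IsUnit (hatMatrix T).det := by
  rw [hatMatrix_det]
  exact (pow_ne_zero 3 (quaternionGroup_normSq_pos T).ne').isUnit

/-! ### The isomorphisms with `ℝ⁺ × SU(2)` and `ℍ^×`. -/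

theorem specialUnitary_snd_col (U : Matrix.specialUnitaryGroup (Fin 2) ℂ) :
    U.1 0 1 = -star (U.1 1 0) ∧ U.1 1 1 = star (U.1 0 0) ∧
      ‖U.1 0 0‖ ^ 2 + ‖U.1 1 0‖ ^ 2 = 1 := by
  obtain ⟨U, hU⟩ := U
  obtain ⟨hu, hdet⟩ := Matrix.mem_specialUnitaryGroup_iff.1 hU
  -- Both matrices are the inverse of `U`: the first by unitarity, the second because `det U = 1`.
  -- Comparing entries gives the shape of the second column.
  have hadj : star U = U.adjugate := by
    have h1 := Matrix.mem_unitaryGroup_iff'.1 hu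
    calc star U = star U * (U * U.adjugate) := by rw [Matrix.mul_adjugate, hdet]; simp
      _ = U.adjugate := by rw [← mul_assoc, h1, one_mul]
  rw [Matrix.adjugate_fin_two] at hadj
  have e1 := congrFun (congrFun hadj 0) 0
  have e2 := congrFun (congrFun hadj 0) 1
  simp only [Matrix.star_apply, Matrix.of_apply, Matrix.cons_val', Matrix.cons_val_zero,
    Matrix.cons_val_one, Matrix.cons_val_fin_one] at e1 e2
  have e3 : U 0 1 = -star (U 1 0) := by rw [e2]; ring
  refine ⟨e3, e1.symm, ?_⟩
  rw [Matrix.det_fin_two, e3, ← e1] at hdet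
  have ha := Complex.mul_conj' (U 0 0)
  have hb := Complex.mul_conj' (U 1 0)
  simp only [Complex.star_def] at hdet
  have : (((‖U 0 0‖ ^ 2 + ‖U 1 0‖ ^ 2 : ℝ)) : ℂ) = 1 := by
    push_cast
    linear_combination hdet - ha - hb
  exact_mod_cast this

/-- The isomorphism `ℝ⁺ × SU(2) ≅ ℍ^×`, `(r, U) ↦ rU`. -/
theorem exists_posReal_prod_specialUnitary_mulEquiv :
    ∃ e : {r : ℝ // 0 < r} × Matrix.specialUnitaryGroup (Fin 2) ℂ ≃* quaternionGroup,
      ∀ r U, ((e (r, U) : GL (Fin 2) ℂ) : Matrix (Fin 2) (Fin 2) ℂ) =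
        ((r : ℝ) : ℂ) • (U : Matrix (Fin 2) (Fin 2) ℂ) := by
  have hnorm : ∀ (r : {r : ℝ // 0 < r}) (U : Matrix.specialUnitaryGroup (Fin 2) ℂ),
      ‖(r : ℂ) * U.1 0 0‖ ^ 2 + ‖(r : ℂ) * U.1 1 0‖ ^ 2 = (r : ℝ) ^ 2 := by
    intro r U
    rw [norm_mul, norm_mul, Complex.norm_real, Real.norm_eq_abs, abs_of_pos r.2]
    linear_combination (r : ℝ) ^ 2 * (specialUnitary_snd_col U).2.2
  let f : {r : ℝ // 0 < r} × Matrix.specialUnitaryGroup (Fin 2) ℂ → quaternionGroup := fun x =>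
    quaternionGroup.mk' ((x.1 : ℝ) * x.2.1 0 0) ((x.1 : ℝ) * x.2.1 1 0)
      (by rw [hnorm]; exact pow_ne_zero 2 x.1.2.ne')
  have hf : ∀ r U, ((f (r, U) : GL (Fin 2) ℂ) : Matrix (Fin 2) (Fin 2) ℂ) =
      ((r : ℝ) : ℂ) • (U : Matrix (Fin 2) (Fin 2) ℂ) := by
    intro r U
    obtain ⟨e1, e2, -⟩ := specialUnitary_snd_col U
    simp only [f, quaternionGroup.mk'_val]
    ext i j
    fin_cases i <;> fin_cases j <;> simp [e1, e2]
  have hmul : ∀ x y, f (x * y) = f x * f y := by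
    rintro ⟨r, U⟩ ⟨r', U'⟩
    refine Subtype.ext (Units.ext ?_)
    change ((f (r * r', U * U') : GL (Fin 2) ℂ) : Matrix (Fin 2) (Fin 2) ℂ) =
      ((f (r, U) : GL (Fin 2) ℂ) : Matrix (Fin 2) (Fin 2) ℂ) *
      ((f (r', U') : GL (Fin 2) ℂ) : Matrix (Fin 2) (Fin 2) ℂ)
    rw [hf, hf, hf, Matrix.smul_mul, Matrix.mul_smul, smul_smul]
    simp
  have hinj : Function.Injective f := by
    rintro ⟨r, U⟩ ⟨r', U'⟩ h
    have hM : ((r : ℝ) : ℂ) • (U : Matrix (Fin 2) (Fin 2) ℂ) =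
        ((r' : ℝ) : ℂ) • (U' : Matrix (Fin 2) (Fin 2) ℂ) := by rw [← hf, ← hf, h]
    -- The scale is recovered as the norm of the first column of `rU`.
    have hr : (r : ℝ) = r' := by
      have h0 := congrFun (congrFun hM 0) 0
      have h1 := congrFun (congrFun hM 1) 0
      simp only [Matrix.smul_apply, smul_eq_mul] at h0 h1
      have h2 := hnorm r U
      rw [h0, h1, hnorm] at h2
      exact ((pow_left_inj₀ r.2.le r'.2.le two_ne_zero).1 h2.symm)
    have hr' : r = r' := Subtype.ext hr
    subst hr'
    refine Prod.ext rfl (Subtype.ext ?_)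
    exact smul_right_injective _ (by exact_mod_cast r.2.ne' : ((r : ℝ) : ℂ) ≠ 0) hM
  have hsurj : Function.Surjective f := by
    intro T
    have hpos := quaternionGroup_normSq_pos T
    obtain ⟨e1, e2⟩ := quaternionGroup_snd_col T
    set N := ‖T.1 0 0‖ ^ 2 + ‖T.1 1 0‖ ^ 2 with hN
    -- Since `det T = N`, the scale must be `√N`, and `T / √N` is the special unitary factor.
    have hs : 0 < √N := Real.sqrt_pos.2 hpos
    have hsc : ((√N : ℝ) : ℂ) ≠ 0 := by exact_mod_cast hs.ne'
    have hsq : ((√N : ℝ) : ℂ) * ((√N : ℝ) : ℂ) =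
        T.1 0 0 * star (T.1 0 0) + T.1 1 0 * star (T.1 1 0) := by
      have ha := Complex.mul_conj' (T.1 0 0)
      have hb := Complex.mul_conj' (T.1 1 0)
      rw [← Complex.ofReal_mul, Real.mul_self_sqrt hpos.le, hN]
      simp only [Complex.star_def]
      rw [ha, hb]
      push_cast
      rfl
    have hT : (T.1 : Matrix (Fin 2) (Fin 2) ℂ) =
        !![T.1 0 0, -star (T.1 1 0); T.1 1 0, star (T.1 0 0)] := by
      rw [← e1, ← e2]
      exact Matrix.eta_fin_two _
    have hmem : ((√N : ℝ) : ℂ)⁻¹ • (T.1 : Matrix (Fin 2) (Fin 2) ℂ) ∈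
        Matrix.specialUnitaryGroup (Fin 2) ℂ := by
      have hstar : star (((√N : ℝ) : ℂ)⁻¹) = ((√N : ℝ) : ℂ)⁻¹ := by simp
      rw [Matrix.mem_specialUnitaryGroup_iff, Matrix.mem_unitaryGroup_iff]
      constructor
      · rw [Matrix.star_eq_conjTranspose, Matrix.conjTranspose_smul, hstar, Matrix.smul_mul,
          Matrix.mul_smul, smul_smul]
        have : (T.1 : Matrix (Fin 2) (Fin 2) ℂ) * (T.1 : Matrix (Fin 2) (Fin 2) ℂ).conjTranspose =
            (((√N : ℝ) : ℂ) * ((√N : ℝ) : ℂ)) • (1 : Matrix (Fin 2) (Fin 2) ℂ) := by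
          rw [hsq, hT]
          ext i j
          fin_cases i <;> fin_cases j <;>
            simp [Matrix.mul_apply, Fin.sum_univ_two, Matrix.conjTranspose_apply] <;> ring
        rw [this, smul_smul]
        rw [show ((√N : ℝ) : ℂ)⁻¹ * ((√N : ℝ) : ℂ)⁻¹ * (((√N : ℝ) : ℂ) * ((√N : ℝ) : ℂ)) = 1 by
          field_simp, one_smul]
      · rw [Matrix.det_smul, Matrix.det_fin_two, e1, e2]
        simp only [Fintype.card_fin]
        field_simp
        rw [pow_two, hsq]
        ring
    refine ⟨(⟨√N, hs⟩, ⟨_, hmem⟩), Subtype.ext (Units.ext ?_)⟩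
    rw [hf]
    simp only [smul_smul, mul_inv_cancel₀ hsc, one_smul]
  exact ⟨MulEquiv.ofBijective (MulHom.mk f hmul) ⟨hinj, hsurj⟩, hf⟩

/-- The quaternion `a + jb`, where `a` and `b` are the entries of the first column. -/
def quaternionGroup.toQuaternion (T : quaternionGroup) : ℍ[ℝ] :=
  -- The sign in the last component comes from `ji = -k`.
  ⟨(T.1 0 0).re, (T.1 0 0).im, (T.1 1 0).re, -(T.1 1 0).im⟩

theorem quaternionGroup.toQuaternion_mul (T T' : quaternionGroup) :
    quaternionGroup.toQuaternion (T * T') =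
      quaternionGroup.toQuaternion T * quaternionGroup.toQuaternion T' := by
  obtain ⟨h0, h1⟩ := quaternionGroup_mul_col T T'
  ext <;> simp only [Quaternion.re_mul, Quaternion.imI_mul, Quaternion.imJ_mul,
    Quaternion.imK_mul] <;> simp only [quaternionGroup.toQuaternion, h0, h1] <;> simp <;> ring

theorem quaternionGroup.toQuaternion_one : quaternionGroup.toQuaternion 1 = 1 := by
  unfold quaternionGroup.toQuaternion
  ext <;> simp

theorem nonempty_units_quaternion_mulEquiv : Nonempty (ℍ[ℝ]ˣ ≃* quaternionGroup) := by
  let f : quaternionGroup →* ℍ[ℝ] :=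
    { toFun := quaternionGroup.toQuaternion
      -- Invertibility of the values is automatic: a monoid homomorphism out of a group lands in the
      -- units.
      map_one' := quaternionGroup.toQuaternion_one
      map_mul' := quaternionGroup.toQuaternion_mul }
  let g : quaternionGroup →* ℍ[ℝ]ˣ := f.toHomUnits
  have hg : ∀ T, (g T : ℍ[ℝ]) = quaternionGroup.toQuaternion T := fun T => rfl
  refine ⟨(MulEquiv.ofBijective g ⟨fun T T' h => ?_, fun q => ?_⟩).symm⟩
  · have h' : quaternionGroup.toQuaternion T = quaternionGroup.toQuaternion T' := by rw [← hg, ← hg, h]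
    exact quaternionGroup.ext_col
      (Complex.ext (congrArg QuaternionAlgebra.re h') (congrArg QuaternionAlgebra.imI h'))
      (Complex.ext (congrArg QuaternionAlgebra.imJ h')
        (neg_injective (congrArg QuaternionAlgebra.imK h')))
  · obtain ⟨q, q', h, h'⟩ := q
    have hq : q ≠ 0 := by rintro rfl; simp at h
    have hn : ‖(⟨q.re, q.imI⟩ : ℂ)‖ ^ 2 + ‖(⟨q.imJ, -q.imK⟩ : ℂ)‖ ^ 2 ≠ 0 := by
      have := Quaternion.normSq_ne_zero.2 hq
      rw [Quaternion.normSq_def'] at this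
      simp only [Complex.sq_norm, Complex.normSq_apply]
      intro h0
      apply this
      linear_combination h0
    refine ⟨quaternionGroup.mk' ⟨q.re, q.imI⟩ ⟨q.imJ, -q.imK⟩ hn, Units.ext ?_⟩
    rw [hg]
    unfold quaternionGroup.toQuaternion
    rw [quaternionGroup.mk'_val]
    ext <;> simp

end Group

/-! ### The action on forms -/

section Action

variable {M : Type*} [TopologicalSpace M] [ChartedSpace ℂ M] [IsManifold 𝓘(ℂ, ℂ) ω M]

/-- On a line spanned by `s₀` with nonzero square the map is `c ↦ c² s₀²`. This makes products of
two functionals independent of the chosen root. -/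
theorem TangentSquareRoot.eq_or_eq_neg_of_sq_eq (S : TangentSquareRoot M) {p : M}
    {s s' : S.fiber p} (h : S.sq p s = S.sq p s') : s = s' ∨ s = -s' := by
  obtain ⟨s₀, hs₀, hgen⟩ := S.exists_generator p
  obtain ⟨a, rfl⟩ := hgen s
  obtain ⟨b, rfl⟩ := hgen s'
  rw [QuadraticMap.map_smul, QuadraticMap.map_smul] at h
  have h' : a * a = b * b := mul_right_cancel₀ (b := (show ℂ from S.sq p s₀)) hs₀ h
  rcases mul_self_eq_mul_self_iff.1 h' with rfl | rfl
  · exact Or.inl rfl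
  · exact Or.inr (neg_smul _ _)

/-- `(ξξ')(s²) = ξ(s) ξ'(s)`. -/
theorem TangentSquareRoot.mulForm_sq (S : TangentSquareRoot M) {p : M}
    (ξ ξ' : S.fiber p →ₗ[ℂ] ℂ) (s : S.fiber p) : S.mulForm ξ ξ' (S.sq p s) = ξ s * ξ' s := by
  change ξ (S.sqrt (S.sq p s)) * ξ' (S.sqrt (S.sq p s)) = _
  rcases S.eq_or_eq_neg_of_sq_eq (S.sq_sqrt (S.sq p s)) with h | h <;> rw [h]
  simp

theorem SpinorRep.form_sq (R : SpinorRep M) (p : M) (s : R.fiber p) :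
    R.form p (R.sq p s) = ![R.u p s ^ 2 - R.v p s ^ 2,
      Complex.I * (R.u p s ^ 2 + R.v p s ^ 2), 2 * (R.u p s * R.v p s)] := by
  ext j
  fin_cases j
  · change R.mulForm (R.u p) (R.u p) _ - R.mulForm (R.v p) (R.v p) _ = _
    simp only [TangentSquareRoot.mulForm_sq]
    simp [pow_two]
  · change Complex.I • (R.mulForm (R.u p) (R.u p) _ + R.mulForm (R.v p) (R.v p) _) = _
    simp only [TangentSquareRoot.mulForm_sq]
    simp [pow_two]
  · change (2 : ℂ) • R.mulForm (R.u p) (R.v p) _ = _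
    simp only [TangentSquareRoot.mulForm_sq]
    simp

/-- Every tangent vector is a square `s²`, which reduces the claim to an identity between quadratic
polynomials in `u(s)` and `v(s)`. The conjugates in the second column of `T` are what make the
coefficients real. -/
theorem SpinorRep.form_act (T : quaternionGroup) (R : SpinorRep M) (p : M)
    (w : TangentSpace 𝓘(ℂ, ℂ) p) :
    (T • R).form p w = ((hatMatrix T).map Complex.ofReal).mulVec (R.form p w) := by
  obtain ⟨s, rfl⟩ := R.sq_surjective p w
  obtain ⟨e1, e2⟩ := quaternionGroup_snd_col T
  have h := (T • R).form_sq p s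
  have hu : (T • R).u p s = T.1 0 0 * R.u p s + T.1 0 1 * R.v p s := rfl
  have hv : (T • R).v p s = T.1 1 0 * R.u p s + T.1 1 1 * R.v p s := rfl
  rw [hu, hv, e1, e2] at h
  refine h.trans ?_
  rw [R.form_sq]
  -- Real parts, imaginary parts and norms are written through `z` and `z̄`, so that `ring` can
  -- treat `a, ā, b, b̄` as independent variables.
  have hre : ∀ z : ℂ, ((z.re : ℝ) : ℂ) = (z + star z) / 2 := fun z => by
    rw [Complex.re_eq_add_conj]; rfl
  have him : ∀ z : ℂ, ((z.im : ℝ) : ℂ) = (z - star z) / (2 * Complex.I) := fun z => by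
    rw [Complex.im_eq_sub_conj]; rfl
  have hnorm : ∀ z : ℂ, ((‖z‖ : ℝ) : ℂ) ^ 2 = z * star z := fun z => (Complex.mul_conj' z).symm
  have hI := Complex.I_sq
  unfold hatMatrix
  generalize T.1 0 0 = a
  generalize T.1 1 0 = b
  generalize R.u p s = x
  generalize R.v p s = y
  ext j
  fin_cases j
  all_goals
    simp only [Matrix.mulVec, dotProduct, Fin.sum_univ_three, Matrix.map_apply, Matrix.of_apply,
      Fin.zero_eta, Fin.mk_one, Fin.reduceFinMk, Matrix.cons_val_zero, Matrix.cons_val_one,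
      Matrix.cons_val, Complex.ofReal_mul, Complex.ofReal_neg, Complex.ofReal_sub,
      Complex.ofReal_pow, Complex.ofReal_ofNat, hre, him, hnorm, star_add, star_sub, star_mul',
      star_star, star_pow]
    field_simp
    ring_nf
    try
      simp only [Complex.I_sq]
      ring

end Action

/-! ### Real linear changes of a triple of forms -/

section RealLinear

/-- Composition with a linear equivalence commutes with `fderiv` even at points of
non-differentiability, so no regularity of `θ` is needed; alternation is linear. -/
theorem extDeriv_ofSubsingleton_comp {E F : Type*} [NormedAddCommGroup E] [NormedSpace ℝ E]
    [NormedAddCommGroup F] [NormedSpace ℝ F] (L : F ≃L[ℝ] F) (θ : E → E →L[ℝ] F) (z : E)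
    (h : extDeriv (fun z => ContinuousAlternatingMap.ofSubsingleton ℝ E F (0 : Fin 1) (θ z)) z = 0) :
    extDeriv (fun z => ContinuousAlternatingMap.ofSubsingleton ℝ E F (0 : Fin 1)
      ((L : F →L[ℝ] F).comp (θ z))) z = 0 := by
  let K : (E [⋀^Fin 1]→L[ℝ] F) ≃L[ℝ] (E [⋀^Fin 1]→L[ℝ] F) :=
    ContinuousLinearEquiv.continuousAlternatingMapCongrRight L
  have hK : (fun z => ContinuousAlternatingMap.ofSubsingleton ℝ E F (0 : Fin 1)
      ((L : F →L[ℝ] F).comp (θ z))) =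
      K ∘ fun z => ContinuousAlternatingMap.ofSubsingleton ℝ E F (0 : Fin 1) (θ z) := by
    funext z
    ext v
    rfl
  rw [hK]
  unfold extDeriv at h ⊢
  rw [ContinuousLinearEquiv.comp_fderiv]
  ext v
  have hv := congrArg (fun a => L (a v)) h
  simp only [ContinuousAlternatingMap.alternatizeUncurryFin_apply, map_sum,
    map_zsmul] at hv
  rw [ContinuousAlternatingMap.alternatizeUncurryFin_apply]
  exact hv.trans (map_zero L)

variable {M : Type*} [TopologicalSpace M] [ChartedSpace ℂ M]

theorem Matrix.re_map_ofReal_mulVec {n : Type*} [Fintype n] (A : Matrix n n ℝ) (v : n → ℂ) (j : n) :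
    ((A.map Complex.ofReal).mulVec v j).re = A.mulVec (fun j => (v j).re) j := by
  simp [Matrix.mulVec, dotProduct]

theorem Matrix.exists_continuousLinearEquiv_mulVec {𝕜 n : Type*} [NontriviallyNormedField 𝕜]
    [CompleteSpace 𝕜] [Fintype n] [DecidableEq n] (A : Matrix n n 𝕜) (hA : IsUnit A.det) :
    ∃ L : (n → 𝕜) ≃L[𝕜] (n → 𝕜), ∀ v, L v = A.mulVec v :=
  ⟨(Matrix.toLinearEquiv' A (Matrix.invertibleOfIsUnitDet A hA)).toContinuousLinearEquiv,
    fun _ => rfl⟩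

theorem TripleForm.Integrability.real_linear {η η' : TripleForm M} (h : η.Integrability)
    (A : Matrix (Fin 3) (Fin 3) ℝ) (hA : IsUnit A.det)
    (hη : ∀ p w, η' p w = (A.map Complex.ofReal).mulVec (η p w)) : η'.Integrability := by
  obtain ⟨L, hL⟩ := A.exists_continuousLinearEquiv_mulVec hA
  intro e he z hz
  have key : ∀ z, η'.reInChart e z = (L : (Fin 3 → ℝ) →L[ℝ] (Fin 3 → ℝ)).comp (η.reInChart e z) := by
    intro z
    ext x j
    have h1 : η'.reInChart e z x j =
        (η' (e.symm z) (mfderiv 𝓘(ℂ, ℂ) 𝓘(ℂ, ℂ) e.symm z x) j).re := rfl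
    rw [h1, hη, Matrix.re_map_ofReal_mulVec, ContinuousLinearMap.comp_apply]
    exact (congrFun (hL _) j).symm
  simp only [key]
  exact extDeriv_ofSubsingleton_comp L _ z (h e he z hz)

theorem TripleForm.PeriodCondition.real_linear {η η' : TripleForm M} (h : η.PeriodCondition)
    (A : Matrix (Fin 3) (Fin 3) ℝ) (hA : IsUnit A.det)
    (hη : ∀ p w, η' p w = (A.map Complex.ofReal).mulVec (η p w)) : η'.PeriodCondition := by
  -- The integral takes values in `ℂ³`, so the matrix is complexified. A linear equivalence commutes
  -- with the integral without any integrability assumption.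
  have hA' : IsUnit (A.map Complex.ofReal).det := by
    have : (A.map Complex.ofReal).det = Complex.ofRealHom A.det :=
      (RingHom.map_det Complex.ofRealHom A).symm
    rw [this]
    exact hA.map Complex.ofRealHom
  obtain ⟨L, hL⟩ := (A.map Complex.ofReal).exists_continuousLinearEquiv_mulVec hA'
  intro γ hγ j
  have key : η'.pathIntegral γ = L (η.pathIntegral γ) := by
    unfold TripleForm.pathIntegral
    rw [intervalIntegral.integral_of_le zero_le_one, intervalIntegral.integral_of_le zero_le_one,
      ← ContinuousLinearEquiv.integral_comp_comm]
    simp only [hη, hL]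
  rw [key, hL, Matrix.re_map_ofReal_mulVec]
  simp only [h γ hγ]
  simp [Matrix.mulVec, dotProduct]

end RealLinear

/-! ### Holomorphic frames of the tangent bundle -/

section Frames

variable {M : Type*} [TopologicalSpace M] [ChartedSpace ℂ M] [IsManifold 𝓘(ℂ, ℂ) ω M]

/-- The differential at `p` of the preferred chart at `p₀`. -/
def tangentCoord (p₀ p : M) : TangentSpace 𝓘(ℂ, ℂ) p →L[ℂ] ℂ :=
  tangentCoordChange 𝓘(ℂ, ℂ) p p₀ p

/-- The coordinate vector field of the preferred chart at `p₀`. -/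
def tangentFrame (p₀ p : M) : TangentSpace 𝓘(ℂ, ℂ) p :=
  tangentCoordChange 𝓘(ℂ, ℂ) p₀ p p (1 : ℂ)

/-- Both sides are the derivative of the same transition map, once over `ℝ` and once over `ℂ`. This
allows real smoothness to be tested with complex-linear frames. -/
theorem tangentCoordChange_real_eq (x y z : M)
    (h : z ∈ (chartAt ℂ x).source ∩ (chartAt ℂ y).source) (v : ℂ) :
    tangentCoordChange 𝓘(ℝ, ℂ) x y z v = tangentCoordChange 𝓘(ℂ, ℂ) x y z v := by
  have h1 := hasFDerivWithinAt_tangentCoordChange (I := 𝓘(ℝ, ℂ)) (x := x) (y := y) (z := z)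
    (by simpa [extChartAt_source] using h)
  have h2 := hasFDerivWithinAt_tangentCoordChange (I := 𝓘(ℂ, ℂ)) (x := x) (y := y) (z := z)
    (by simpa [extChartAt_source] using h)
  simp only [modelWithCornersSelf_coe, Set.range_id, hasFDerivWithinAt_univ] at h1 h2
  have h3 := h2.restrictScalars ℝ
  have := HasFDerivAt.unique h1 h3
  rw [this]
  rfl

theorem tangentCoord_frame {p₀ p : M} (h : p ∈ (chartAt ℂ p₀).source) :
    tangentCoord p₀ p (tangentFrame p₀ p) = 1 := by
  unfold tangentCoord tangentFrame
  have h' : p ∈ (extChartAt 𝓘(ℂ, ℂ) p₀).source := by simpa [extChartAt_source] using h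
  erw [tangentCoordChange_comp ⟨⟨h', mem_extChartAt_source p⟩, h'⟩, tangentCoordChange_self h']

theorem tangentCoord_smul_frame {p₀ p : M} (h : p ∈ (chartAt ℂ p₀).source)
    (w : TangentSpace 𝓘(ℂ, ℂ) p) : tangentCoord p₀ p w • tangentFrame p₀ p = w := by
  have h' : p ∈ (extChartAt 𝓘(ℂ, ℂ) p₀).source := by simpa [extChartAt_source] using h
  have h1 : tangentCoord p₀ p w • tangentFrame p₀ p =
      tangentCoordChange 𝓘(ℂ, ℂ) p₀ p p (tangentCoordChange 𝓘(ℂ, ℂ) p p₀ p w) := by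
    unfold tangentFrame tangentCoord
    erw [← map_smul]
    congr 1
    exact mul_one (M := ℂ) _
  rw [h1]
  erw [tangentCoordChange_comp ⟨⟨mem_extChartAt_source p, h'⟩, mem_extChartAt_source p⟩,
    tangentCoordChange_self (mem_extChartAt_source p)]

theorem TripleForm.apply_eq_smul_frame (η : TripleForm M) {p₀ p : M}
    (h : p ∈ (chartAt ℂ p₀).source) (w : TangentSpace 𝓘(ℂ, ℂ) p) :
    η p w = tangentCoord p₀ p w • η p (tangentFrame p₀ p) := by
  rw [← map_smul, tangentCoord_smul_frame h]

variable {E H N : Type*} [NormedAddCommGroup E] [NormedSpace ℝ E] [TopologicalSpace H]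
  {I : ModelWithCorners ℝ E H} [TopologicalSpace N] [ChartedSpace H N]

/-- Smoothness of a map into the tangent bundle, in terms of a holomorphic frame. -/
theorem contMDiffAt_tangentBundle_iff {f : N → TangentBundle 𝓘(ℝ, ℂ) M} {x : N} {p₀ : M}
    (hp₀ : (f x).1 = p₀) :
    ContMDiffAt I 𝓘(ℝ, ℂ).tangent ∞ f x ↔ ContMDiffAt I 𝓘(ℝ, ℂ) ∞ (fun y => (f y).1) x ∧
      ContMDiffAt I 𝓘(ℝ, ℂ) ∞ (fun y => tangentCoord p₀ (f y).1 (f y).2) x := by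
  subst hp₀
  rw [Bundle.contMDiffAt_totalSpace]
  refine and_congr_right fun hf => Filter.EventuallyEq.contMDiffAt_iff ?_
  have := hf.continuousAt.preimage_mem_nhds
    ((chartAt ℂ (f x).1).open_source.mem_nhds (mem_chart_source ℂ (f x).1))
  filter_upwards [this] with y hy
  exact tangentCoordChange_real_eq _ _ _ ⟨mem_chart_source ℂ (f y).1, hy⟩ (f y).2

theorem contMDiffAt_tangentFrame (p₀ : M) :
    ContMDiffAt 𝓘(ℝ, ℂ) 𝓘(ℝ, ℂ).tangent ∞
      (fun p => (⟨p, tangentFrame p₀ p⟩ : TangentBundle 𝓘(ℝ, ℂ) M)) p₀ := by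
  rw [contMDiffAt_tangentBundle_iff (p₀ := p₀) rfl]
  refine ⟨contMDiffAt_id, (contMDiffAt_const (c := (1 : ℂ))).congr_of_eventuallyEq ?_⟩
  filter_upwards [(chartAt ℂ p₀).open_source.mem_nhds (mem_chart_source ℂ p₀)] with p hp
  exact tangentCoord_frame hp

theorem contMDiffAt_tangentCoord (w : TangentBundle 𝓘(ℝ, ℂ) M) :
    ContMDiffAt 𝓘(ℝ, ℂ).tangent 𝓘(ℝ, ℂ) ∞
      (fun w' : TangentBundle 𝓘(ℝ, ℂ) M => tangentCoord w.1 w'.1 w'.2) w :=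
  ((contMDiffAt_tangentBundle_iff (f := id) rfl).1 contMDiffAt_id).2

theorem ContMDiffAt.complex_smul {F : Type*} [NormedAddCommGroup F] [NormedSpace ℝ F]
    [NormedSpace ℂ F] [IsScalarTower ℝ ℂ F] {f : N → ℂ} {g : N → F} {x : N}
    (hf : ContMDiffAt I 𝓘(ℝ, ℂ) ∞ f x) (hg : ContMDiffAt I 𝓘(ℝ, F) ∞ g x) :
    ContMDiffAt I 𝓘(ℝ, F) ∞ (fun y => f y • g y) x :=
  (isBoundedBilinearMap_smul (𝕜 := ℝ) (A := ℂ) (E := F)).contDiff.contMDiff.contMDiffAt.comp x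
    (hf.prodMk_space hg)

/-- Smoothness of a triple of `(1,0)`-forms can be tested on holomorphic frames. -/
theorem TripleForm.contMDiff_iff (η : TripleForm M) :
    ContMDiff 𝓘(ℝ, ℂ).tangent 𝓘(ℝ, Fin 3 → ℂ) ∞
      (fun w : TangentBundle 𝓘(ℝ, ℂ) M => η w.1 w.2) ↔
    ∀ p₀, ContMDiffAt 𝓘(ℝ, ℂ) 𝓘(ℝ, Fin 3 → ℂ) ∞ (fun p => η p (tangentFrame p₀ p)) p₀ := by
  constructor
  · intro h p₀
    exact (h _).comp p₀ (contMDiffAt_tangentFrame p₀)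
  · intro h w
    have hproj : ContMDiffAt 𝓘(ℝ, ℂ).tangent 𝓘(ℝ, ℂ) ∞
        (fun w : TangentBundle 𝓘(ℝ, ℂ) M => w.1) w := Bundle.contMDiffAt_proj _
    have h1 := (contMDiffAt_tangentCoord w).complex_smul ((h w.1).comp w hproj)
    refine h1.congr_of_eventuallyEq ?_
    filter_upwards [hproj.continuousAt.preimage_mem_nhds
      ((chartAt ℂ w.1).open_source.mem_nhds (mem_chart_source ℂ w.1))] with w' hw'
    exact η.apply_eq_smul_frame hw' w'.2

end Frames

/-! ### The Weierstrass representation of a spinor representation -/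

section FormOfSpinor

variable {M : Type*} [TopologicalSpace M] [ChartedSpace ℂ M] [IsManifold 𝓘(ℂ, ℂ) ω M]

theorem TangentSquareRoot.sq_ne_zero (S : TangentSquareRoot M) {p : M} {s : S.fiber p}
    (hs : s ≠ 0) : S.sq p s ≠ 0 := by
  obtain ⟨s₀, hs₀, hgen⟩ := S.exists_generator p
  obtain ⟨a, rfl⟩ := hgen s
  rw [QuadraticMap.map_smul]
  have ha : a ≠ 0 := by
    rintro rfl
    exact hs (zero_smul _ _)
  exact mul_ne_zero (M₀ := ℂ) (mul_ne_zero ha ha) hs₀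

theorem SpinorRep.form_isotropic (R : SpinorRep M) (p : M) (w : TangentSpace 𝓘(ℂ, ℂ) p) :
    ∑ j, R.form p w j ^ 2 = 0 := by
  obtain ⟨s, rfl⟩ := R.sq_surjective p w
  rw [R.form_sq, Fin.sum_univ_three]
  simp only [Matrix.cons_val_zero, Matrix.cons_val_one, Matrix.cons_val]
  linear_combination (R.u p s ^ 2 + R.v p s ^ 2) ^ 2 * Complex.I_sq

theorem SpinorRep.form_ne_zero (R : SpinorRep M) (p : M) : R.form p ≠ 0 := by
  intro h
  have h1 : ∀ s, R.u p s = 0 ∧ R.v p s = 0 := by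
    intro s
    have h2 := R.form_sq p s
    rw [h] at h2
    have e0 : 0 = R.u p s ^ 2 - R.v p s ^ 2 := congrFun h2 0
    have e1 : 0 = Complex.I * (R.u p s ^ 2 + R.v p s ^ 2) := congrFun h2 1
    have e2 := (mul_eq_zero.1 e1.symm).resolve_left Complex.I_ne_zero
    have e3 : R.u p s ^ 2 = 0 := by linear_combination (e2 - e0) / 2
    have e4 : R.v p s ^ 2 = 0 := by linear_combination (e2 + e0) / 2
    exact ⟨pow_eq_zero_iff two_ne_zero |>.1 e3, pow_eq_zero_iff two_ne_zero |>.1 e4⟩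
  exact R.ne_zero p ⟨LinearMap.ext fun s => (h1 s).1, LinearMap.ext fun s => (h1 s).2⟩

/-- For smoothness, a chosen square root does not vary smoothly by itself. A local nonvanishing
section `s` of `S` does, and `s²` is a nonvanishing smooth multiple `g` of the coordinate frame. On
that frame the form equals `g⁻¹` times a polynomial in `u(s)` and `v(s)`. -/
theorem SpinorRep.form_isWeierstrass (R : SpinorRep M) : R.form.IsWeierstrass := by
  refine ⟨R.form.contMDiff_iff.2 fun p₀ => ?_, R.form_ne_zero, R.form_isotropic⟩
  let e := trivializationAt ℂ R.fiber p₀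
  have hp₀ : p₀ ∈ e.baseSet := FiberBundle.mem_baseSet_trivializationAt' p₀
  let s : ∀ p, R.fiber p := fun p => e.symm p 1
  have hes : ∀ p ∈ e.baseSet, (e ⟨p, s p⟩).2 = 1 := fun p hp => by
    rw [e.apply_mk_symm hp]
  have hs : ContMDiffAt 𝓘(ℝ, ℂ) (𝓘(ℝ, ℂ).prod 𝓘(ℝ, ℂ)) ∞
      (fun p => (⟨p, s p⟩ : Bundle.TotalSpace ℂ R.fiber)) p₀ := by
    refine (Bundle.contMDiffAt_section p₀).2
      ((contMDiffAt_const (c := (1 : ℂ))).congr_of_eventuallyEq ?_)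
    filter_upwards [e.open_baseSet.mem_nhds hp₀] with p hp using hes p hp
  have hs0 : s p₀ ≠ 0 := by
    intro h0
    have h1 := hes p₀ hp₀
    rw [h0] at h1
    have h2 : (e ⟨p₀, 0⟩).2 = 0 := congrArg Prod.snd (e.zeroSection ℂ hp₀)
    exact zero_ne_one (h2.symm.trans h1)
  let g : M → ℂ := fun p => tangentCoord p₀ p (R.sq p (s p))
  have hg : ContMDiffAt 𝓘(ℝ, ℂ) 𝓘(ℝ, ℂ) ∞ g p₀ :=
    ((contMDiffAt_tangentBundle_iff (p₀ := p₀) rfl).1 ((R.sq_smooth _).comp p₀ hs)).2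
  have hg0 : g p₀ ≠ 0 := by
    intro h0
    have h1 := tangentCoord_smul_frame (mem_chart_source ℂ p₀) (R.sq p₀ (s p₀))
    change g p₀ • _ = _ at h1
    rw [h0, zero_smul] at h1
    exact R.sq_ne_zero hs0 h1.symm
  have hu : ContMDiffAt 𝓘(ℝ, ℂ) 𝓘(ℝ, ℂ) ∞ (fun p => R.u p (s p)) p₀ :=
    (R.u_smooth _).comp p₀ hs
  have hv : ContMDiffAt 𝓘(ℝ, ℂ) 𝓘(ℝ, ℂ) ∞ (fun p => R.v p (s p)) p₀ :=
    (R.v_smooth _).comp p₀ hs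
  let Φ : ℂ × ℂ → Fin 3 → ℂ := fun x =>
    ![x.1 ^ 2 - x.2 ^ 2, Complex.I * (x.1 ^ 2 + x.2 ^ 2), 2 * (x.1 * x.2)]
  have hΦ : ContDiff ℝ ∞ Φ := by
    refine contDiff_pi.2 fun j => ?_
    fin_cases j <;> simp [Φ] <;> fun_prop
  have hinv : ContMDiffAt 𝓘(ℝ, ℂ) 𝓘(ℝ, ℂ) ∞ (fun p => (g p)⁻¹) p₀ :=
    (contDiffAt_inv ℝ hg0).contMDiffAt.comp p₀ hg
  refine (hinv.complex_smul (hΦ.contMDiff.contMDiffAt.comp p₀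
    (hu.prodMk_space hv))).congr_of_eventuallyEq ?_
  filter_upwards [hg.continuousAt.eventually_ne hg0,
    (chartAt ℂ p₀).open_source.mem_nhds (mem_chart_source ℂ p₀)] with p hgp hp
  have h1 : tangentFrame p₀ p = (g p)⁻¹ • R.sq p (s p) := by
    have := tangentCoord_smul_frame hp (R.sq p (s p))
    change g p • _ = _ at this
    rw [← this, smul_smul, inv_mul_cancel₀ hgp, one_smul]
  rw [h1, map_smul, R.form_sq]
  rfl

end FormOfSpinor

/-! ### The spinor representation of a Weierstrass representation -/

/-- The isotropic coordinates `x₀ - i x₁` and `-(x₀ + i x₁)` of `ℂ³`. -/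
def isotropicCoord : Bool → (Fin 3 → ℂ) →L[ℂ] ℂ
  | false => ContinuousLinearMap.proj (R := ℂ) (φ := fun _ : Fin 3 => ℂ) 0 -
      Complex.I • ContinuousLinearMap.proj (R := ℂ) (φ := fun _ : Fin 3 => ℂ) 1
  | true => -(ContinuousLinearMap.proj (R := ℂ) (φ := fun _ : Fin 3 => ℂ) 0 +
      Complex.I • ContinuousLinearMap.proj (R := ℂ) (φ := fun _ : Fin 3 => ℂ) 1)

theorem isotropicCoord_false (x : Fin 3 → ℂ) :
    isotropicCoord false x = x 0 - Complex.I * x 1 := rfl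

theorem isotropicCoord_true (x : Fin 3 → ℂ) :
    isotropicCoord true x = -(x 0 + Complex.I * x 1) := rfl

/-- At `(u² - v², i(u² + v²), 2uv)` the two coordinates are `2u²` and `2v²`. Consequently `ratio
false true` is `v / u` and `ratio true false` is `u / v`. -/
theorem isotropicCoord_mul {x : Fin 3 → ℂ} (h : ∑ j, x j ^ 2 = 0) {i j : Bool} (hij : i ≠ j) :
    isotropicCoord i x * isotropicCoord j x = x 2 ^ 2 := by
  rw [Fin.sum_univ_three] at h
  have key : isotropicCoord false x * isotropicCoord true x = x 2 ^ 2 := by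
    rw [isotropicCoord_false, isotropicCoord_true]
    linear_combination x 1 ^ 2 * Complex.I_sq - h
  cases i <;> cases j
  · exact absurd rfl hij
  · exact key
  · rw [mul_comm]; exact key
  · exact absurd rfl hij

section SpinorOfForm

variable {M : Type*} [TopologicalSpace M] [ChartedSpace ℂ M]

/-- The value of `η` on the preferred coordinate vector at `p`. -/
def TripleForm.value (η : TripleForm M) (p : M) : Fin 3 → ℂ :=
  η p (show TangentSpace 𝓘(ℂ, ℂ) p from (1 : ℂ))

theorem TripleForm.apply_eq_smul_value (η : TripleForm M) (p : M) (w : TangentSpace 𝓘(ℂ, ℂ) p) :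
    η p w = (show ℂ from w) • η.value p := by
  unfold TripleForm.value
  rw [← map_smul]
  congr 1
  exact (mul_one (M := ℂ) _).symm

theorem TripleForm.isotropicCoord_value_mul {η : TripleForm M}
    (hη : ∀ p w, ∑ j, η p w j ^ 2 = 0) {i j : Bool} (h : i ≠ j) (p : M) :
    isotropicCoord i (η.value p) * isotropicCoord j (η.value p) = η.value p 2 ^ 2 :=
  isotropicCoord_mul (hη p _) h

/-- The change of coordinates in the tautological line bundle: the quotient of the homogeneous
coordinates with indices `j` and `i` of the point of `ℙ¹` corresponding to `η p`. -/
def TripleForm.ratio (η : TripleForm M) (i j : Bool) (p : M) : ℂ :=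
  if i = j then 1 else η.value p 2 / isotropicCoord i (η.value p)

theorem TripleForm.ratio_self (η : TripleForm M) (i : Bool) (p : M) : η.ratio i i p = 1 :=
  if_pos rfl

theorem TripleForm.ratio_ne (η : TripleForm M) {i j : Bool} (h : i ≠ j) (p : M) :
    η.ratio i j p = η.value p 2 / isotropicCoord i (η.value p) := if_neg h

/-- The cocycle condition of the tautological bundle. With only two indices, the one nontrivial case
is `(v / u)(u / v) = 1`. -/
theorem TripleForm.ratio_mul_ratio {η : TripleForm M} (hη : ∀ p w, ∑ j, η p w j ^ 2 = 0)
    {i k : Bool} (j : Bool) {p : M} (hi : isotropicCoord i (η.value p) ≠ 0)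
    (hk : isotropicCoord k (η.value p) ≠ 0) :
    η.ratio i j p * η.ratio k i p = η.ratio k j p := by
  rcases eq_or_ne k i with rfl | hki
  · rw [η.ratio_self, mul_one]
  rcases eq_or_ne i j with rfl | hij
  · rw [η.ratio_self, one_mul]
  have hkj : k = j := by cases k <;> cases i <;> cases j <;> simp_all
  subst hkj
  rw [η.ratio_self, η.ratio_ne hij, η.ratio_ne hki]
  have := isotropicCoord_value_mul hη hij p
  field_simp
  exact this.symm

/-- This makes the squaring map `z ↦ 2z² / D`, with `D` the isotropic coordinate of the
trivialization in use, independent of that trivialization. -/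
theorem TripleForm.div_isotropicCoord_eq {η : TripleForm M} (hη : ∀ p w, ∑ j, η p w j ^ 2 = 0)
    {i k : Bool} {p : M} (hi : isotropicCoord i (η.value p) ≠ 0)
    (hk : isotropicCoord k (η.value p) ≠ 0) :
    η.ratio i k p ^ 2 / isotropicCoord k (η.value p) = 1 / isotropicCoord i (η.value p) := by
  rcases eq_or_ne i k with rfl | hik
  · rw [η.ratio_self, one_pow]
  rw [η.ratio_ne hik]
  have := isotropicCoord_value_mul hη hik p
  field_simp
  exact this.symm

theorem TripleForm.ratio_mul_ratio_mul_isotropicCoord {η : TripleForm M}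
    (hη : ∀ p w, ∑ j, η p w j ^ 2 = 0) {i : Bool} {p : M}
    (hi : isotropicCoord i (η.value p) ≠ 0) :
    η.ratio i false p ^ 2 * isotropicCoord i (η.value p) = isotropicCoord false (η.value p) ∧
    η.ratio i true p ^ 2 * isotropicCoord i (η.value p) = isotropicCoord true (η.value p) ∧
    η.ratio i false p * η.ratio i true p * isotropicCoord i (η.value p) = η.value p 2 := by
  cases i
  · have := isotropicCoord_value_mul hη (i := false) (j := true) (by simp) p
    rw [η.ratio_self, η.ratio_ne (by simp)]
    refine ⟨by ring, ?_, ?_⟩ <;> field_simp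
    exact this.symm
  · have := isotropicCoord_value_mul hη (i := true) (j := false) (by simp) p
    rw [η.ratio_self, η.ratio_ne (by simp)]
    refine ⟨?_, by ring, ?_⟩ <;> field_simp
    exact this.symm

/-- If both vanished, then so would `x₀` and `x₁`, and by isotropy `x₂`. Hence the two base sets
cover `M`. -/
theorem TripleForm.IsWeierstrass.isotropicCoord_ne_zero [IsManifold 𝓘(ℂ, ℂ) ω M] {η : TripleForm M}
    (hη : η.IsWeierstrass) (p : M) :
    isotropicCoord false (η.value p) ≠ 0 ∨ isotropicCoord true (η.value p) ≠ 0 := by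
  by_contra! h
  obtain ⟨h0, h1⟩ := h
  have h2 := isotropicCoord_value_mul hη.isotropic (i := false) (j := true) (by simp) p
  rw [h0, zero_mul] at h2
  rw [isotropicCoord_false] at h0
  rw [isotropicCoord_true] at h1
  have e0 : η.value p 0 = 0 := by linear_combination (h0 - h1) / 2
  have e1 : η.value p 1 = 0 :=
    (mul_eq_zero.1 (by linear_combination -(h0 + h1) / 2 : Complex.I * η.value p 1 = 0)).resolve_left
      Complex.I_ne_zero
  have e2 : η.value p 2 = 0 := pow_eq_zero_iff two_ne_zero |>.1 h2.symm
  have e : η.value p = 0 := by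
    ext j
    fin_cases j
    exacts [e0, e1, e2]
  refine hη.ne_zero p (ContinuousLinearMap.ext fun w => ?_)
  rw [η.apply_eq_smul_value, e, smul_zero]
  rfl

variable [IsManifold 𝓘(ℂ, ℂ) ω M]

/-- The vector used in `value` depends on the preferred chart at `p`, so `value` need not be
continuous. It differs from the smooth local frame only by a nonzero factor, which affects neither
ratios nor nonvanishing. -/
theorem TripleForm.value_eq_smul_frame (η : TripleForm M) {p₀ p : M}
    (h : p ∈ (chartAt ℂ p₀).source) :
    ∃ c : ℂ, c ≠ 0 ∧ c = tangentCoord p₀ p (show TangentSpace 𝓘(ℂ, ℂ) p from (1 : ℂ)) ∧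
      η.value p = c • η p (tangentFrame p₀ p) := by
  refine ⟨_, fun h0 => ?_, rfl, η.apply_eq_smul_frame h _⟩
  have := tangentCoord_smul_frame h (show TangentSpace 𝓘(ℂ, ℂ) p from (1 : ℂ))
  rw [h0, zero_smul] at this
  exact zero_ne_one (α := ℂ) this

/-! ### The tautological bundle, its squaring map and its homogeneous coordinates. -/

namespace TripleForm.IsWeierstrass

variable {η : TripleForm M}

theorem contMDiffAt_frame (hη : η.IsWeierstrass) (p₀ : M) :
    ContMDiffAt 𝓘(ℝ, ℂ) 𝓘(ℝ, Fin 3 → ℂ) ∞ (fun p => η p (tangentFrame p₀ p)) p₀ :=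
  η.contMDiff_iff.1 hη.smooth p₀

theorem contMDiffAt_isotropicCoord_frame (hη : η.IsWeierstrass) (i : Bool) (p₀ : M) :
    ContMDiffAt 𝓘(ℝ, ℂ) 𝓘(ℝ, ℂ) ∞ (fun p => isotropicCoord i (η p (tangentFrame p₀ p))) p₀ :=
  ((isotropicCoord i).restrictScalars ℝ).contDiff.contMDiff.contMDiffAt.comp p₀
    (hη.contMDiffAt_frame p₀)

theorem isotropicCoord_frame_ne_zero {i : Bool} {p₀ : M}
    (h : isotropicCoord i (η.value p₀) ≠ 0) :
    isotropicCoord i (η p₀ (tangentFrame p₀ p₀)) ≠ 0 := by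
  obtain ⟨c, -, -, hc⟩ := η.value_eq_smul_frame (mem_chart_source ℂ p₀)
  rw [hc, map_smul] at h
  exact right_ne_zero_of_smul h

theorem isOpen_isotropicCoord_ne_zero (hη : η.IsWeierstrass) (i : Bool) :
    IsOpen {p | isotropicCoord i (η.value p) ≠ 0} := by
  refine isOpen_iff_mem_nhds.2 fun p₀ hp₀ => ?_
  filter_upwards [(hη.contMDiffAt_isotropicCoord_frame i p₀).continuousAt.eventually_ne
    (isotropicCoord_frame_ne_zero hp₀),
    (chartAt ℂ p₀).open_source.mem_nhds (mem_chart_source ℂ p₀)] with p h hp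
  obtain ⟨c, hc0, -, hc⟩ := η.value_eq_smul_frame hp
  rw [hc, map_smul]
  exact smul_ne_zero hc0 h

theorem contMDiffAt_ratio (hη : η.IsWeierstrass) {i : Bool} (j : Bool) {p₀ : M}
    (h : isotropicCoord i (η.value p₀) ≠ 0) :
    ContMDiffAt 𝓘(ℝ, ℂ) 𝓘(ℝ, ℂ) ∞ (η.ratio i j) p₀ := by
  rcases eq_or_ne i j with rfl | hij
  · rw [show η.ratio i i = fun _ => 1 from funext (η.ratio_self i)]
    exact contMDiffAt_const
  have h2 : ContMDiffAt 𝓘(ℝ, ℂ) 𝓘(ℝ, ℂ) ∞ (fun p => η p (tangentFrame p₀ p) 2) p₀ :=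
    (ContinuousLinearMap.proj (R := ℝ) (φ := fun _ : Fin 3 => ℂ)
      2).contDiff.contMDiff.contMDiffAt.comp p₀ (hη.contMDiffAt_frame p₀)
  have h3 : ContMDiffAt 𝓘(ℝ, ℂ) 𝓘(ℝ, ℂ) ∞
      (fun p => (isotropicCoord i (η p (tangentFrame p₀ p)))⁻¹) p₀ :=
    (contDiffAt_inv ℝ (isotropicCoord_frame_ne_zero h)).contMDiffAt.comp p₀
      (hη.contMDiffAt_isotropicCoord_frame i p₀)
  refine (h3.complex_smul h2).congr_of_eventuallyEq ?_
  filter_upwards [(chartAt ℂ p₀).open_source.mem_nhds (mem_chart_source ℂ p₀)] with p hp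
  obtain ⟨c, hc0, -, hc⟩ := η.value_eq_smul_frame hp
  -- The ratio is homogeneous of degree zero, so the possibly discontinuous factor `c` cancels.
  rw [η.ratio_ne hij, hc, map_smul, Pi.smul_apply, smul_eq_mul, smul_eq_mul, smul_eq_mul,
    mul_div_mul_left _ _ hc0, div_eq_inv_mul]

open Classical in
/-- The tautological line bundle of a Weierstrass representation, that is, the pull-back of the
tautological bundle of `ℙ¹` along `M → ℙ(Q) ≅ ℙ¹`. -/
def spinorCore (hη : η.IsWeierstrass) : VectorBundleCore ℂ M ℂ Bool where
  baseSet i := {p | isotropicCoord i (η.value p) ≠ 0}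
  isOpen_baseSet := hη.isOpen_isotropicCoord_ne_zero
  indexAt p := if isotropicCoord false (η.value p) ≠ 0 then false else true
  mem_baseSet_at p := by
    change isotropicCoord (if isotropicCoord false (η.value p) ≠ 0 then false else true) _ ≠ 0
    split_ifs with h
    · exact h
    · exact (hη.isotropicCoord_ne_zero p).resolve_left h
  coordChange i j p := η.ratio i j p • ContinuousLinearMap.id ℂ ℂ
  coordChange_self i p _ v := by simp [η.ratio_self]
  continuousOn_coordChange i j p hp :=
    ((hη.contMDiffAt_ratio j hp.1).continuousAt.smul continuousAt_const).continuousWithinAt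
  coordChange_comp i j k p hp v := by
    have := ratio_mul_ratio hη.isotropic k hp.1.2 hp.1.1
    simp only [smul_apply, ContinuousLinearMap.id_apply, smul_eq_mul]
    rw [← this, mul_assoc]

theorem coordChangeL_spinorCore (hη : η.IsWeierstrass) {i j : Bool}
    [(hη.spinorCore.localTriv i).IsLinear ℝ] [(hη.spinorCore.localTriv j).IsLinear ℝ] {p : M}
    (hp : p ∈ hη.spinorCore.baseSet i ∩ hη.spinorCore.baseSet j) (v : ℂ) :
    (hη.spinorCore.localTriv i).coordChangeL ℝ (hη.spinorCore.localTriv j) p v =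
      η.ratio i j p • v := by
  rw [Bundle.Trivialization.coordChangeL_apply _ _ hp]
  have := hη.spinorCore.localTriv_coordChange_eq i j hp v
  rw [Bundle.Trivialization.coordChangeL_apply _ _ hp] at this
  exact this

/-- The transition functions are complex-linear on fibres but only real-smooth in the base point,
because `η` need not be holomorphic. -/
theorem contMDiffVectorBundle_spinorCore (hη : η.IsWeierstrass) :
    ContMDiffVectorBundle (𝕜 := ℝ) ∞ ℂ hη.spinorCore.Fiber 𝓘(ℝ, ℂ) where
  contMDiffOn_coordChangeL := by
    rintro - - ⟨i, rfl⟩ ⟨j, rfl⟩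
    have h : ContMDiffOn 𝓘(ℝ, ℂ) 𝓘(ℝ, ℂ →L[ℝ] ℂ) ∞
        (fun p => η.ratio i j p • ContinuousLinearMap.id ℝ ℂ)
        (hη.spinorCore.baseSet i ∩ hη.spinorCore.baseSet j) := fun p hp =>
      ((hη.contMDiffAt_ratio j hp.1).complex_smul contMDiffAt_const).contMDiffWithinAt
    have hlin : ∀ i, (hη.spinorCore.localTriv i).IsLinear ℝ := fun i =>
      have : MemTrivializationAtlas (hη.spinorCore.localTriv i) := ⟨⟨i, rfl⟩⟩
      trivialization_linear ℝ _
    have := hlin i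
    have := hlin j
    refine h.congr fun p hp => ?_
    exact ContinuousLinearMap.ext fun v => hη.coordChangeL_spinorCore hp v


attribute [local instance] contMDiffVectorBundle_spinorCore

theorem isotropicCoord_indexAt_ne_zero (hη : η.IsWeierstrass) (p : M) :
    isotropicCoord (hη.spinorCore.indexAt p) (η.value p) ≠ 0 :=
  hη.spinorCore.mem_baseSet_at p

/-- The fibre coordinate in the preferred trivialization at `p₀`. -/
theorem trivializationAt_spinorCore (hη : η.IsWeierstrass) (p₀ : M)
    (s : Bundle.TotalSpace ℂ hη.spinorCore.Fiber) :
    (trivializationAt ℂ hη.spinorCore.Fiber p₀ s).2 =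
      η.ratio (hη.spinorCore.indexAt s.1) (hη.spinorCore.indexAt p₀) s.1 * (show ℂ from s.2) :=
  rfl

theorem contMDiffAt_trivializationAt_spinorCore (hη : η.IsWeierstrass)
    (s : Bundle.TotalSpace ℂ hη.spinorCore.Fiber) :
    ContMDiffAt (𝓘(ℝ, ℂ).prod 𝓘(ℝ, ℂ)) 𝓘(ℝ, ℂ) ∞
      (fun s' : Bundle.TotalSpace ℂ hη.spinorCore.Fiber => (trivializationAt ℂ hη.spinorCore.Fiber s.1 s').2) s :=
  (Bundle.contMDiffAt_totalSpace.1 (contMDiffAt_id (x := s))).2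

theorem eventually_spinorCore (hη : η.IsWeierstrass)
    (s : Bundle.TotalSpace ℂ hη.spinorCore.Fiber) :
    ∀ᶠ s' in nhds s, isotropicCoord (hη.spinorCore.indexAt s.1) (η.value s'.1) ≠ 0 :=
  (Bundle.contMDiffAt_proj (n := ∞) (IB := 𝓘(ℝ, ℂ)) hη.spinorCore.Fiber
    (p := s)).continuousAt.preimage_mem_nhds
    ((hη.isOpen_isotropicCoord_ne_zero _).mem_nhds (hη.isotropicCoord_indexAt_ne_zero s.1))

/-- A homogeneous coordinate, as a functional on the tautological line. -/
def spinorCoord (hη : η.IsWeierstrass) (j : Bool) (p : M) : hη.spinorCore.Fiber p →ₗ[ℂ] ℂ :=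
  show ℂ →ₗ[ℂ] ℂ from η.ratio (hη.spinorCore.indexAt p) j p • LinearMap.id

theorem spinorCoord_apply (hη : η.IsWeierstrass) (j : Bool) (p : M) (s : hη.spinorCore.Fiber p) :
    hη.spinorCoord j p s = η.ratio (hη.spinorCore.indexAt p) j p * (show ℂ from s) := rfl

theorem contMDiff_spinorCoord (hη : η.IsWeierstrass) (j : Bool) :
    ContMDiff (𝓘(ℝ, ℂ).prod 𝓘(ℝ, ℂ)) 𝓘(ℝ, ℂ) ∞
      (fun s : Bundle.TotalSpace ℂ hη.spinorCore.Fiber => hη.spinorCoord j s.1 s.2) := by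
  intro s
  have hs := hη.isotropicCoord_indexAt_ne_zero s.1
  refine (((hη.contMDiffAt_ratio j hs).comp s (Bundle.contMDiffAt_proj _)).complex_smul
    (hη.contMDiffAt_trivializationAt_spinorCore s)).congr_of_eventuallyEq ?_
  filter_upwards [hη.eventually_spinorCore s] with s' hs'
  -- The cocycle identity replaces the index chosen at `s'.1`, which may jump, by the fixed index at
  -- `s.1`.
  rw [trivializationAt_spinorCore, spinorCoord_apply, smul_eq_mul, Function.comp_apply, ← mul_assoc,
    ratio_mul_ratio hη.isotropic j hs' (hη.isotropicCoord_indexAt_ne_zero s'.1)]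

/-- The quadratic map from the tautological line to the tangent space. -/
def spinorSq (hη : η.IsWeierstrass) (p : M) :
    QuadraticMap ℂ (hη.spinorCore.Fiber p) (TangentSpace 𝓘(ℂ, ℂ) p) :=
  show QuadraticMap ℂ ℂ ℂ from
    (2 / isotropicCoord (hη.spinorCore.indexAt p) (η.value p)) • QuadraticMap.sq

theorem spinorSq_apply (hη : η.IsWeierstrass) (p : M) (s : hη.spinorCore.Fiber p) :
    hη.spinorSq p s = (show TangentSpace 𝓘(ℂ, ℂ) p from
      2 / isotropicCoord (hη.spinorCore.indexAt p) (η.value p) *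
        ((show ℂ from s) * (show ℂ from s))) := rfl

theorem spinorSq_surjective (hη : η.IsWeierstrass) (p : M) :
    Function.Surjective (hη.spinorSq p) := by
  intro w
  obtain ⟨z, hz⟩ := IsAlgClosed.exists_eq_mul_self
    (isotropicCoord (hη.spinorCore.indexAt p) (η.value p) / 2 * (show ℂ from w))
  refine ⟨z, ?_⟩
  change 2 / isotropicCoord (hη.spinorCore.indexAt p) (η.value p) * (z * z) = (show ℂ from w)
  have := hη.isotropicCoord_indexAt_ne_zero p
  rw [← hz]
  field_simp

theorem contMDiff_spinorSq (hη : η.IsWeierstrass) :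
    ContMDiff (𝓘(ℝ, ℂ).prod 𝓘(ℝ, ℂ)) 𝓘(ℝ, ℂ).tangent ∞
      (fun s : Bundle.TotalSpace ℂ hη.spinorCore.Fiber =>
        (⟨s.1, hη.spinorSq s.1 s.2⟩ : TangentBundle 𝓘(ℝ, ℂ) M)) := by
  intro s
  have hs := hη.isotropicCoord_indexAt_ne_zero s.1
  have hproj : ContMDiffAt (𝓘(ℝ, ℂ).prod 𝓘(ℝ, ℂ)) 𝓘(ℝ, ℂ) ∞
    (fun s : Bundle.TotalSpace ℂ hη.spinorCore.Fiber => s.1) s := Bundle.contMDiffAt_proj _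
  refine (contMDiffAt_tangentBundle_iff (p₀ := s.1) rfl).2 ⟨hproj, ?_⟩
  set k := hη.spinorCore.indexAt s.1 with hk
  have hz := hη.contMDiffAt_trivializationAt_spinorCore s
  have hinv : ContMDiffAt 𝓘(ℝ, ℂ) 𝓘(ℝ, ℂ) ∞
      (fun p => (isotropicCoord k (η p (tangentFrame s.1 p)))⁻¹) s.1 :=
    (contDiffAt_inv ℝ (isotropicCoord_frame_ne_zero hs)).contMDiffAt.comp s.1
      (hη.contMDiffAt_isotropicCoord_frame k s.1)
  -- In the trivialization and frame fixed at `s.1`, the squaring map becomes `2z² / D`, where `D`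
  -- is the isotropic coordinate of `η` on the frame.
  refine ((hinv.comp s hproj).complex_smul ((contMDiffAt_const (c := (2 : ℂ))).complex_smul
    (hz.complex_smul hz))).congr_of_eventuallyEq ?_
  filter_upwards [hη.eventually_spinorCore s, hproj.continuousAt.preimage_mem_nhds
      ((chartAt ℂ s.1).open_source.mem_nhds (mem_chart_source ℂ s.1))] with s' hs' hp
  obtain ⟨c, hc0, hc1, hc⟩ := η.value_eq_smul_frame hp
  have hi := hη.isotropicCoord_indexAt_ne_zero s'.1
  have h1 := div_isotropicCoord_eq hη.isotropic hi hs'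
  have h2 : tangentCoord s.1 s'.1 (hη.spinorSq s'.1 s'.2) =
      (2 / isotropicCoord (hη.spinorCore.indexAt s'.1) (η.value s'.1) *
        ((show ℂ from s'.2) * (show ℂ from s'.2))) * c := by
    rw [hc1, ← smul_eq_mul, ← map_smul]
    congr 1
    exact (mul_one (M := ℂ) _).symm
  refine h2.trans ?_
  rw [trivializationAt_spinorCore]
  simp only [smul_eq_mul, Function.comp_apply]
  rw [← hk] at hs' ⊢
  have key : ∀ z r D D' : ℂ, r ^ 2 / D = 1 / D' →
      2 / D' * (z * z) * c = c / D * (2 * ((r * z) * (r * z))) := fun z r D D' h => by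
    linear_combination (-2 * c * z ^ 2) * h
  have h3 : c / isotropicCoord k (η.value s'.1) =
      (isotropicCoord k (η s'.1 (tangentFrame s.1 s'.1)))⁻¹ := by
    rw [hc, map_smul, smul_eq_mul, div_mul_cancel_left₀ hc0]
  rw [← h3]
  exact key s'.2 _ _ _ h1

/-- The spinor representation of a Weierstrass representation. -/
def spinorRep (hη : η.IsWeierstrass) : SpinorRep M where
  fiber := hη.spinorCore.Fiber
  sq := hη.spinorSq
  sq_surjective := hη.spinorSq_surjective
  sq_smooth := hη.contMDiff_spinorSq
  u := hη.spinorCoord false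
  v := hη.spinorCoord true
  u_smooth := hη.contMDiff_spinorCoord false
  v_smooth := hη.contMDiff_spinorCoord true
  ne_zero p := by
    rintro ⟨h0, h1⟩
    have e : hη.spinorCoord (hη.spinorCore.indexAt p) p = 0 := by
      cases hη.spinorCore.indexAt p
      exacts [h0, h1]
    have e1 := LinearMap.congr_fun e (show hη.spinorCore.Fiber p from (1 : ℂ))
    rw [spinorCoord_apply, η.ratio_self] at e1
    exact one_ne_zero ((mul_one (1 : ℂ)).symm.trans e1)

/-- With fibre coordinate `z` and isotropic coordinate `D`, the vector is `s² = 2z² / D`. The factor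
`2` compensates for the isotropic coordinates being `2u²` and `2v²`. -/
theorem form_spinorRep (hη : η.IsWeierstrass) : hη.spinorRep.form = η := by
  refine funext fun p => ContinuousLinearMap.ext fun w => ?_
  obtain ⟨s, rfl⟩ := hη.spinorSq_surjective p w
  refine (hη.spinorRep.form_sq p s).trans ?_
  rw [η.apply_eq_smul_value, spinorSq_apply]
  obtain ⟨h0, h1, h2⟩ := ratio_mul_ratio_mul_isotropicCoord hη.isotropic
    (hη.isotropicCoord_indexAt_ne_zero p)
  have hD := hη.isotropicCoord_indexAt_ne_zero p
  rw [isotropicCoord_false] at h0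
  rw [isotropicCoord_true] at h1
  have key : ∀ z r r' D : ℂ, D ≠ 0 → r ^ 2 * D = η.value p 0 - Complex.I * η.value p 1 →
      r' ^ 2 * D = -(η.value p 0 + Complex.I * η.value p 1) → r * r' * D = η.value p 2 →
      ![(r * z) ^ 2 - (r' * z) ^ 2, Complex.I * ((r * z) ^ 2 + (r' * z) ^ 2),
        2 * (r * z * (r' * z))] = (2 / D * (z * z)) • η.value p := by
    intro z r r' D hD h0 h1 h2
    ext j
    fin_cases j
    all_goals
      simp only [Fin.zero_eta, Fin.mk_one, Fin.reduceFinMk, Matrix.cons_val_zero,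
        Matrix.cons_val_one, Matrix.cons_val, Pi.smul_apply, smul_eq_mul]
      field_simp
    · linear_combination z ^ 2 * (h0 - h1)
    · linear_combination z ^ 2 * (Complex.I * (h0 + h1) - 2 * η.value p 1 * Complex.I_sq)
    · linear_combination z ^ 2 * h2
  exact key s _ _ _ hD h0 h1 h2

end TripleForm.IsWeierstrass

end SpinorOfForm

/-! ### Conformal immersions -/

section Immersions

variable {M : Type*} [TopologicalSpace M] [ChartedSpace ℂ M]

/-- The triple of `(1,0)`-forms `2∂φ`. -/
def twoPartial (φ : M → EuclideanSpace ℝ (Fin 3)) : TripleForm M := fun p =>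
  show ℂ →L[ℂ] (Fin 3 → ℂ) from ContinuousLinearMap.toSpanSingleton ℂ fun j =>
    (differential φ p 1 j : ℂ) - Complex.I * (differential φ p Complex.I j : ℂ)

theorem twoPartial_isInducedBy (φ : M → EuclideanSpace ℝ (Fin 3)) :
    (twoPartial φ).IsInducedBy φ := by
  intro p w j
  have key : ∀ (D : ℂ →L[ℝ] EuclideanSpace ℝ (Fin 3)) (z : ℂ),
      z * ((D 1 j : ℂ) - Complex.I * (D Complex.I j : ℂ)) =
        (D z j : ℂ) - Complex.I * (D (Complex.I * z) j : ℂ) := by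
    intro D z
    -- A real-linear map on `ℂ` is determined by its values at `1` and `i`.
    have h : ∀ z : ℂ, D z j = z.re * D 1 j + z.im * D Complex.I j := fun z => by
      have : z = z.re • (1 : ℂ) + z.im • Complex.I := by simp
      conv_lhs => rw [this, map_add, map_smul, map_smul]
      rfl
    rw [h z, h (Complex.I * z)]
    nth_rewrite 1 [← Complex.re_add_im z]
    simp only [Complex.I_mul_re, Complex.I_mul_im]
    push_cast
    linear_combination (-(z.im : ℂ) * (D Complex.I j : ℂ)) * Complex.I_sq
  exact key (differential φ p) w

/-- The form recovers the differential as its real part, so two maps inducing the same form have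
equal differentials. -/
theorem TripleForm.IsInducedBy.re_eq {η : TripleForm M} {φ : M → EuclideanSpace ℝ (Fin 3)}
    (h : η.IsInducedBy φ) (p : M) (w : ℂ) (j : Fin 3) :
    (η p (show TangentSpace 𝓘(ℂ, ℂ) p from w) j).re = differential φ p w j := by
  rw [h]
  simp

theorem differential_unique {η : TripleForm M} {φ ψ : M → EuclideanSpace ℝ (Fin 3)}
    (h : η.IsInducedBy φ) (h' : η.IsInducedBy ψ) (p : M) :
    differential φ p = differential ψ p := by
  ext w j
  rw [← h.re_eq, ← h'.re_eq]

/-- The sum equals `|D1|² - |Di|² - 2i⟨D1, Di⟩`, and conformality makes `D1` and `Di` orthogonal and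
of equal length. -/
theorem IsConformalMap.sum_sq_eq_zero {D : ℂ →L[ℝ] EuclideanSpace ℝ (Fin 3)}
    (hD : IsConformalMap D) :
    ∑ j, ((D 1 j : ℂ) - Complex.I * (D Complex.I j : ℂ)) ^ 2 = 0 := by
  obtain ⟨c, -, hc⟩ := (isConformalMap_iff D).1 hD
  have h0 := hc 1 1
  have h1 := hc Complex.I Complex.I
  have h2 := hc 1 Complex.I
  simp only [PiLp.inner_apply, Fin.sum_univ_three, Complex.inner] at h0 h1 h2
  simp at h0 h1 h2
  have h3 : D 1 0 * D 1 0 + D 1 1 * D 1 1 + D 1 2 * D 1 2 = D Complex.I 0 * D Complex.I 0 +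
    D Complex.I 1 * D Complex.I 1 + D Complex.I 2 * D Complex.I 2 := by linarith
  have h3' := congrArg Complex.ofReal h3
  have h2' := congrArg Complex.ofReal h2
  push_cast at h2' h3'
  rw [Fin.sum_univ_three]
  linear_combination h3' - 2 * Complex.I * h2' + ((D Complex.I 0 : ℂ) ^ 2 +
    (D Complex.I 1 : ℂ) ^ 2 + (D Complex.I 2 : ℂ) ^ 2) * Complex.I_sq

variable [IsManifold 𝓘(ℂ, ℂ) ω M]

theorem contMDiffAt_I_smul_tangentFrame (p₀ : M) :
    ContMDiffAt 𝓘(ℝ, ℂ) 𝓘(ℝ, ℂ).tangent ∞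
      (fun p => (⟨p, Complex.I • tangentFrame p₀ p⟩ : TangentBundle 𝓘(ℝ, ℂ) M)) p₀ := by
  rw [contMDiffAt_tangentBundle_iff (p₀ := p₀) rfl]
  refine ⟨contMDiffAt_id, (contMDiffAt_const (c := Complex.I)).congr_of_eventuallyEq ?_⟩
  filter_upwards [(chartAt ℂ p₀).open_source.mem_nhds (mem_chart_source ℂ p₀)] with p hp
  have : tangentCoord p₀ p (Complex.I • tangentFrame p₀ p) = Complex.I := by
    rw [map_smul, tangentCoord_frame hp, smul_eq_mul, mul_one]
  exact this

theorem ContMDiff.contMDiff_differential {φ : M → EuclideanSpace ℝ (Fin 3)}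
    (hφ : ContMDiff 𝓘(ℝ, ℂ) 𝓘(ℝ, EuclideanSpace ℝ (Fin 3)) ∞ φ) :
    ContMDiff 𝓘(ℝ, ℂ).tangent 𝓘(ℝ, EuclideanSpace ℝ (Fin 3)) ∞
      (fun w : TangentBundle 𝓘(ℝ, ℂ) M => differential φ w.1 w.2) :=
  (contMDiff_snd_tangentBundle_modelSpace (EuclideanSpace ℝ (Fin 3))
    𝓘(ℝ, EuclideanSpace ℝ (Fin 3))).comp (hφ.contMDiff_tangentMap (m := ∞) (by simp))

theorem IsConformalImmersion.isWeierstrass_twoPartial {φ : M → EuclideanSpace ℝ (Fin 3)}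
    (hφ : IsConformalImmersion φ) : (twoPartial φ).IsWeierstrass := by
  refine ⟨(twoPartial φ).contMDiff_iff.2 fun p₀ => ?_, fun p h0 => ?_, fun p w => ?_⟩
  · have h1 := (hφ.smooth.contMDiff_differential _).comp p₀ (contMDiffAt_tangentFrame p₀)
    have h2 := (hφ.smooth.contMDiff_differential _).comp p₀ (contMDiffAt_I_smul_tangentFrame p₀)
    let Ψ : EuclideanSpace ℝ (Fin 3) × EuclideanSpace ℝ (Fin 3) → Fin 3 → ℂ := fun x j =>
      (x.1 j : ℂ) - Complex.I * (x.2 j : ℂ)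
    have hΨ : ContDiff ℝ ∞ Ψ := by
      refine contDiff_pi.2 fun j => ?_
      have hj : ContDiff ℝ ∞ fun x : EuclideanSpace ℝ (Fin 3) => (x j : ℂ) :=
        Complex.ofRealCLM.contDiff.comp (contDiff_euclidean.1 contDiff_id j)
      exact (hj.comp contDiff_fst).sub (contDiff_const.mul (hj.comp contDiff_snd))
    refine (hΨ.contMDiff.contMDiffAt.comp p₀ (h1.prodMk_space h2)).congr_of_eventuallyEq ?_
    exact Filter.Eventually.of_forall fun p => funext fun j => twoPartial_isInducedBy φ p _ j
  -- Vanishing of the form would force `dφ(1) = 0`, contradicting injectivity of a conformal map.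
  · obtain ⟨c, hc, li, hli⟩ := hφ.conformal p
    have h1 : differential φ p 1 = 0 := by
      ext j
      rw [← (twoPartial_isInducedBy φ).re_eq, h0]
      rfl
    rw [hli] at h1
    have h2 : li 1 = 0 := (smul_eq_zero.1 h1).resolve_left hc
    exact one_ne_zero (li.injective (h2.trans li.map_zero.symm))
  · have h := (hφ.conformal p).sum_sq_eq_zero
    have key : ∀ (z : ℂ) (v : Fin 3 → ℂ), ∑ j, v j ^ 2 = 0 → ∑ j, (z • v) j ^ 2 = 0 := by
      intro z v hv
      simp only [Pi.smul_apply, smul_eq_mul, mul_pow]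
      rw [← Finset.mul_sum, hv, mul_zero]
    exact key w _ h

theorem exists_spinorRep_isInducedBy {φ : M → EuclideanSpace ℝ (Fin 3)}
    (hφ : IsConformalImmersion φ) : ∃ R : SpinorRep M, R.form.IsInducedBy φ :=
  ⟨hφ.isWeierstrass_twoPartial.spinorRep, by
    rw [hφ.isWeierstrass_twoPartial.form_spinorRep]
    exact twoPartial_isInducedBy φ⟩

end Immersions

/-! ### Similarities of `ℝ³` and uniqueness up to translation. -/

section Motions

variable {M : Type*} [TopologicalSpace M] [ChartedSpace ℂ M]

theorem isConformalMap_hatMatrix (T : quaternionGroup) :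
    IsConformalMap (Matrix.toEuclideanCLM (𝕜 := ℝ) (hatMatrix T)) := by
  have hpos := quaternionGroup_normSq_pos T
  refine (isConformalMap_iff _).2 ⟨_, pow_pos hpos 2, fun u v => ?_⟩
  -- The identity matrix is used to express the inner product itself as a dot product; then `T̂ᵀT̂`
  -- being scalar gives conformality.
  have huv := Matrix.inner_toEuclideanCLM 1 u v
  rw [map_one, Matrix.one_mulVec, one_apply_eq_self] at huv
  rw [Matrix.inner_toEuclideanCLM, Matrix.ofLp_toEuclideanCLM, huv, ← Matrix.vecMul_transpose,
    ← Matrix.dotProduct_mulVec, Matrix.mulVec_mulVec, hatMatrix_transpose_mul, Matrix.smul_mulVec,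
    Matrix.one_mulVec, dotProduct_smul, smul_eq_mul]

theorem form_act_isInducedBy [IsManifold 𝓘(ℂ, ℂ) ω M] {φ : M → EuclideanSpace ℝ (Fin 3)}
    {R : SpinorRep M} (h : R.form.IsInducedBy φ) (T : quaternionGroup)
    {ψ : M → EuclideanSpace ℝ (Fin 3)} (hψ : ∀ p, differential ψ p =
      (Matrix.toEuclideanCLM (𝕜 := ℝ) (hatMatrix T)).comp (differential φ p)) :
    (T • R).form.IsInducedBy ψ := by
  intro p w j
  have key : ∀ z : ℂ, differential ψ p z j = ∑ k, hatMatrix T j k * differential φ p z k := by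
    intro z
    rw [hψ, ContinuousLinearMap.comp_apply, Matrix.ofLp_toEuclideanCLM]
    rfl
  rw [SpinorRep.form_act]
  have h1 : R.form p w = fun k => (differential φ p w k : ℂ) -
      Complex.I * (differential φ p (Complex.I • w) k : ℂ) := funext (h p w)
  rw [h1]
  refine Eq.trans ?_ (congrArg₂ (fun a b : ℝ => (a : ℂ) - Complex.I * (b : ℂ)) (key w)
    (key (Complex.I • w))).symm
  simp only [Matrix.mulVec, dotProduct, Fin.sum_univ_three, Matrix.map_apply]
  push_cast
  ring

theorem differential_affine {φ : M → EuclideanSpace ℝ (Fin 3)}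
    (A : EuclideanSpace ℝ (Fin 3) →L[ℝ] EuclideanSpace ℝ (Fin 3)) (x : EuclideanSpace ℝ (Fin 3))
    {p : M} (hφ : MDifferentiableAt 𝓘(ℝ, ℂ) 𝓘(ℝ, EuclideanSpace ℝ (Fin 3)) φ p) :
    differential (fun p => A (φ p) + x) p = A.comp (differential φ p) :=
  (((A.hasFDerivAt (x := φ p)).add_const x).hasMFDerivAt.comp p hφ.hasMFDerivAt).mfderiv

/-- A differentiable map on a connected surface is constant if its differential vanishes. -/
theorem eq_of_mfderiv_eq_zero [IsManifold 𝓘(ℝ, ℂ) 1 M] [ConnectedSpace M]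
    {F : Type*} [NormedAddCommGroup F]
    [NormedSpace ℝ F] {f : M → F} (hf : MDifferentiable 𝓘(ℝ, ℂ) 𝓘(ℝ, F) f)
    (h0 : ∀ p, mfderiv 𝓘(ℝ, ℂ) 𝓘(ℝ, F) f p = 0) (p q : M) : f p = f q := by
  suffices h : IsLocallyConstant f from h.apply_eq_of_isPreconnected isPreconnected_univ
    (Set.mem_univ p) (Set.mem_univ q)
  refine (IsLocallyConstant.iff_eventually_eq f).2 fun p => ?_
  let e := chartAt ℂ p
  have hg : ∀ z ∈ e.target, HasFDerivAt (𝕜 := ℝ) (f ∘ e.symm) 0 z := by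
    intro z hz
    have h1 := (hf (e.symm z)).hasMFDerivAt.comp z
      (mdifferentiableAt_atlas_symm (I := 𝓘(ℝ, ℂ)) (chart_mem_atlas ℂ p) hz).hasMFDerivAt
    rw [h0] at h1
    exact hasMFDerivAt_iff_hasFDerivAt.1 (h1.congr_mfderiv (ContinuousLinearMap.zero_comp _))
  -- The chart's target may be disconnected, so only local constancy is extracted here;
  -- connectedness enters globally on `M`.
  have h2 := e.open_target.isOpen_inter_preimage_of_fderiv_eq_zero (𝕜 := ℝ) (f := f ∘ e.symm)
    (fun z hz => (hg z hz).differentiableAt.differentiableWithinAt)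
    (fun z hz => (hg z hz).fderiv) {f p}
  have hp := mem_chart_source ℂ p
  have h3 := e.isOpen_inter_preimage h2
  filter_upwards [h3.mem_nhds ⟨hp, e.map_source hp, by simp [e.left_inv hp]⟩] with q hq
  have : f (e.symm (e q)) = f p := hq.2.2
  rwa [e.left_inv hq.1] at this

theorem IsConformalImmersion.affine {φ : M → EuclideanSpace ℝ (Fin 3)}
    (hφ : IsConformalImmersion φ) {A : EuclideanSpace ℝ (Fin 3) →L[ℝ] EuclideanSpace ℝ (Fin 3)}
    (hA : IsConformalMap A) (x : EuclideanSpace ℝ (Fin 3)) :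
    IsConformalImmersion fun p => A (φ p) + x where
  smooth := (A.contDiff.add contDiff_const).contMDiff.comp hφ.smooth
  conformal p := by
    rw [differential_affine A x (hφ.smooth.mdifferentiable (by simp) p)]
    exact hA.comp (hφ.conformal p)

/-- Maps with the same differential on a connected surface differ by a translation. -/
theorem exists_eq_add_of_differential_eq [IsManifold 𝓘(ℂ, ℂ) ω M] [ConnectedSpace M]
    {φ ψ : M → EuclideanSpace ℝ (Fin 3)} (hφ : IsConformalImmersion φ)
    (hψ : IsConformalImmersion ψ) (h : ∀ p, differential ψ p = differential φ p) :
    ∃ x, ∀ p, ψ p = φ p + x := by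
  have hφ' := hφ.smooth.mdifferentiable (by simp)
  have hψ' := hψ.smooth.mdifferentiable (by simp)
  have h0 : ∀ p, mfderiv 𝓘(ℝ, ℂ) 𝓘(ℝ, EuclideanSpace ℝ (Fin 3)) (ψ - φ) p = 0 := fun p => by
    rw [mfderiv_sub (hψ' p) (hφ' p)]
    exact sub_eq_zero.2 (h p)
  obtain ⟨p₀⟩ := (inferInstance : Nonempty M)
  refine ⟨ψ p₀ - φ p₀, fun p => ?_⟩
  have h1 : ψ p - φ p = ψ p₀ - φ p₀ :=
    eq_of_mfderiv_eq_zero (fun p => (hψ' p).sub (hφ' p)) h0 p p₀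
  rw [← h1]
  abel

end Motions

end

theorem mainTheorem12 {M : Type*} [TopologicalSpace M] [ChartedSpace ℂ M]
    [IsManifold 𝓘(ℂ, ℂ) ω M] :
    -- the group: `ℝ⁺ × SU(2) ≅ ℍ^×`
    (∃ e : {r : ℝ // 0 < r} × Matrix.specialUnitaryGroup (Fin 2) ℂ ≃* quaternionGroup,
      ∀ r U, ((e (r, U) : GL (Fin 2) ℂ) : Matrix (Fin 2) (Fin 2) ℂ) =
        ((r : ℝ) : ℂ) • (U : Matrix (Fin 2) (Fin 2) ℂ)) ∧
    Nonempty (ℍ[ℝ]ˣ ≃* quaternionGroup) ∧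
    -- spinor representations induce precisely the Weierstrass representations of `M`
    (∀ R : SpinorRep M, R.form.IsWeierstrass) ∧
    (∀ η : TripleForm M, η.IsWeierstrass → ∃ R : SpinorRep M, R.form = η) ∧
    -- the action preserves the integrability condition and the period condition
    (∀ (T : quaternionGroup) (R : SpinorRep M),
      (R.form.Integrability → (T • R).form.Integrability) ∧
      (R.form.PeriodCondition → (T • R).form.PeriodCondition)) ∧
    -- on Weierstrass representations, `T` acts by the matrix `T̂`, which lies in `ℝ⁺ × SO(3)`
    (∀ (T : quaternionGroup) (R : SpinorRep M) p w,
      (T • R).form p w = ((hatMatrix T).map Complex.ofReal).mulVec (R.form p w)) ∧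
    (∀ T : quaternionGroup, 0 < ‖T.1 0 0‖ ^ 2 + ‖T.1 1 0‖ ^ 2 ∧
      ∃ O ∈ Matrix.specialOrthogonalGroup (Fin 3) ℝ,
        hatMatrix T = (‖T.1 0 0‖ ^ 2 + ‖T.1 1 0‖ ^ 2) • O) ∧
    (∀ T T' : quaternionGroup, hatMatrix (T * T' : quaternionGroup) = hatMatrix T * hatMatrix T') ∧
    -- the induced action on conformal immersions modulo translations is `φ ↦ T̂ ∘ φ`
    (∀ φ : M → EuclideanSpace ℝ (Fin 3), IsConformalImmersion φ →
      (∃ R : SpinorRep M, R.form.IsInducedBy φ) ∧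
      ∀ R : SpinorRep M, R.form.IsInducedBy φ → ∀ T : quaternionGroup,
        (∀ x : EuclideanSpace ℝ (Fin 3),
          IsConformalImmersion (fun p => Matrix.toEuclideanCLM (𝕜 := ℝ) (hatMatrix T) (φ p) + x) ∧
          (T • R).form.IsInducedBy
            (fun p => Matrix.toEuclideanCLM (𝕜 := ℝ) (hatMatrix T) (φ p) + x)) ∧
        (ConnectedSpace M → ∀ ψ : M → EuclideanSpace ℝ (Fin 3), IsConformalImmersion ψ →
          (T • R).form.IsInducedBy ψ →
          ∃ x, ∀ p, ψ p = Matrix.toEuclideanCLM (𝕜 := ℝ) (hatMatrix T) (φ p) + x)) := by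
  refine ⟨exists_posReal_prod_specialUnitary_mulEquiv, nonempty_units_quaternion_mulEquiv,
    SpinorRep.form_isWeierstrass, fun η hη => ⟨hη.spinorRep, hη.form_spinorRep⟩, fun T R =>
    ⟨fun h => h.real_linear _ (hatMatrix_isUnit_det T) (SpinorRep.form_act T R),
      fun h => h.real_linear _ (hatMatrix_isUnit_det T) (SpinorRep.form_act T R)⟩,
    SpinorRep.form_act, fun T => ⟨quaternionGroup_normSq_pos T, exists_hatMatrix_eq_smul T⟩,
    hatMatrix_mul, fun φ hφ => ⟨exists_spinorRep_isInducedBy hφ, fun R hR T => ?_⟩⟩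
  have hdiff : ∀ x p, differential
      (fun p => Matrix.toEuclideanCLM (𝕜 := ℝ) (hatMatrix T) (φ p) + x) p =
      (Matrix.toEuclideanCLM (𝕜 := ℝ) (hatMatrix T)).comp (differential φ p) := fun x p =>
    differential_affine _ x (hφ.smooth.mdifferentiable (by simp) p)
  refine ⟨fun x => ⟨hφ.affine (isConformalMap_hatMatrix T) x,
    form_act_isInducedBy hR T (hdiff x)⟩, fun hM ψ hψ hTψ => ?_⟩
  -- The comparison map is `T̂ ∘ φ` with zero translation. It induces the same form as `ψ`, so the
  -- differentials agree.
  obtain ⟨x, hx⟩ := exists_eq_add_of_differential_eq (hφ.affine (isConformalMap_hatMatrix T) 0) hψ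
    fun p => differential_unique hTψ (form_act_isInducedBy hR T (hdiff 0)) p
  exact ⟨x, fun p => by rw [hx p, add_zero]⟩
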